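/- Let $\kappa$ and $\lambda$ be infinite cardinals, and let $\mathbb F_\kappa$, $\mathbb F_\lambda$ be the free groups of rank $\kappa$, $\lambda$. Then, for every weak modulus $\Omega$ and every ordinal $\alpha$ (countable or not), $$L(\mathbb F_\kappa)\equiv^{\mathrm{bf},\Omega}_\alpha L(\mathbb F_\lambda)\qquad\text{and}\qquad C^*_r(\mathbb F_\kappa)\equiv^{\mathrm{bf},\Omega}_\alpha C^*_r(\mathbb F_\lambda);$$ that is, $L(\mathbb F_\kappa)\equiv^\Omega_{\infty,\omega}L(\mathbb F_\lambda)$ and $C^*_r(\mathbb F_\kappa)\equiv^\Omega_{\infty,\omega}C^*_r(\mathbb F_\lambda)$ for every weak modulus $\Omega$. Here, for a group $G$ with left regular representation $\lambda_G$ on $\ell^2(G)$, $C^*_r(G)$ and $L(G)$ are the operator norm closure and the strong operator closure of the linear span of $\lambda_G(G)$ in $\mathcal B(\ell^2(G))$. Both are metric structures whose sorts are the operator norm balls of radius $n$ ($n\ge 1$), with function symbols for $0$, $1$, addition, multiplication, scalar multiplication by each complex number, adjoint, and inclusions of balls. The metric is that of the operator norm for $C^*_r(G)$; for $L(G)$ it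 is that of the norm $\|x\|_2=\sqrt{\mathrm{tr}(x^*x)}$, where $\mathrm{tr}(x)=\langle x\delta_e,\delta_e\rangle$, and there are also predicates for the real and imaginary parts of the trace. A weak modulus is a function $\Omega:[0,\infty)^{\mathbb N}\to[0,\infty]$ that is non-decreasing, subadditive, zero at $0$, lower semicontinuous for the product topology, and continuous in each argument. Every term and every atomic formula carries a formal modulus, obtained by composing the moduli of its symbols. A basic formula $f(\varphi_1,\dots,\varphi_k)$, with $\varphi_i$ atomic and $f$ continuous on the product $K$ of their bounding compact intervals, has formal modulus $\Delta_f\circ(\Delta_{\varphi_1},\dots,\Delta_{\varphi_k})$, where $\Delta_f(\eta)=\sup\{|f(x)-f(y)|: x,y\in K,\ |x_i-y_i|\le\eta_i\ \text{for all } i\}$; it is a basic $\Omega$-formula if its formal modulus is at most $\Omega$. For finite tuples $\vec a$ from $M$ and $\vec b$ from $N$ of the same length with corresponding entries of the same sort, put $r_0(\vec a,\vec b)=\sup_\varphi|\varphi^M(\vec a)-\varphi^N(\vec b)|$, the supremum over all basic $\Omega$-formulas in the variables of these sorts, and for $\alpha>0$ $$r_\alpha(\vec a,\vec b)=\max\Big(\sup_{\beta<\alpha}\sup_{\vec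 c\in M}\inf_{\vec d\in N}r_\beta(\vec a\vec c,\vec b\vec d),\ \sup_{\beta<\alpha}\sup_{\vec d\in N}\inf_{\vec c\in M}r_\beta(\vec a\vec c,\vec b\vec d)\Big),$$ where $\vec c,\vec d$ range over finite tuples of arbitrary length with matching sorts. Then $M\equiv^{\mathrm{bf},\Omega}_\alpha N$ means $r_\alpha(\varnothing,\varnothing)=0$, and $M\equiv^\Omega_{\infty,\omega}N$ means that this holds for all ordinals $\alpha$. -/

import Mathlib

open scoped NNReal ENNReal

universe u v v' w

namespace ContLogic

/-- An `n`-ary modulus. -/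
structure Modulus (n : ℕ) where
  toFun : (Fin n → ℝ≥0) → ℝ≥0
  mono : Monotone toFun
  subadd : ∀ x y, toFun (x + y) ≤ toFun x + toFun y
  map_zero : toFun 0 = 0
  continuous : Continuous toFun

/-- The linear modulus `δ ↦ ∑ i, c i * δ i`. -/
def Modulus.linear {n : ℕ} (c : Fin n → ℝ≥0) : Modulus n where
  toFun δ := ∑ i, c i * δ i
  mono := fun _ _ h => Finset.sum_le_sum fun i _ => mul_le_mul_right (h i) _
  subadd := fun x y => by simp [mul_add, Finset.sum_add_distrib]
  map_zero := by simp
  continuous := by fun_prop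

/-- A weak modulus: a function `[0,∞)^ℕ → [0,∞]` that is non-decreasing, subadditive, vanishing at
zero, lower semicontinuous for the product topology and continuous in each argument. -/
structure WeakModulus where
  toFun : (ℕ → ℝ≥0) → ℝ≥0∞
  mono : Monotone toFun
  subadd : ∀ x y, toFun (x + y) ≤ toFun x + toFun y
  map_zero : toFun 0 = 0
  lsc : LowerSemicontinuous toFun
  continuous_update : ∀ (δ : ℕ → ℝ≥0) (i : ℕ),
    Continuous fun t : ℝ≥0 => toFun (Function.update δ i t)

/-- A many-sorted language of continuous logic. The distinguished metrics are logical symbols; `diam s`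
bounds the metric of sort `s`. -/
structure MetricLanguage where
  Srt : Type
  diam : Srt → ℝ≥0
  Fn : Type
  fnArity : Fn → ℕ
  fnDom : ∀ f : Fn, Fin (fnArity f) → Srt
  fnCod : Fn → Srt
  fnMod : ∀ f : Fn, Modulus (fnArity f)
  Rel : Type
  relArity : Rel → ℕ
  relDom : ∀ R : Rel, Fin (relArity R) → Srt
  relMod : ∀ R : Rel, Modulus (relArity R)
  relLo : Rel → ℝ
  relHi : Rel → ℝ

/-- A metric structure: complete bounded metric spaces, together with functions and bounded
real-valued predicates that obey the moduli and bounds prescribed by the language. -/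
structure MetricStructure (L : MetricLanguage) where
  carrier : L.Srt → Type v
  [metric : ∀ s, MetricSpace (carrier s)]
  complete : ∀ s, CompleteSpace (carrier s)
  nndist_le : ∀ s (x y : carrier s), nndist x y ≤ L.diam s
  fn : ∀ f : L.Fn, (∀ i, carrier (L.fnDom f i)) → carrier (L.fnCod f)
  fn_obeys : ∀ (f : L.Fn) (x y : ∀ i, carrier (L.fnDom f i)),
    nndist (fn f x) (fn f y) ≤ (L.fnMod f).toFun fun i => nndist (x i) (y i)
  rel : ∀ R : L.Rel, (∀ i, carrier (L.relDom R i)) → ℝ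
  rel_obeys : ∀ (R : L.Rel) (x y : ∀ i, carrier (L.relDom R i)),
    nndist (rel R x) (rel R y) ≤ (L.relMod R).toFun fun i => nndist (x i) (y i)
  rel_mem : ∀ (R : L.Rel) (x : ∀ i, carrier (L.relDom R i)),
    rel R x ∈ Set.Icc (L.relLo R) (L.relHi R)

attribute [instance] MetricStructure.metric

/-- Finite tuples whose entries belong to a prescribed list of sorts. -/
def Tuple {S : Type} (X : S → Type v) : List S → Type v
  | [] => PUnit
  | s :: Γ => X s × Tuple X Γ

/-- The `i`-th entry of a tuple. -/
def Tuple.get {S : Type} {X : S → Type v} : {Γ : List S} → Tuple X Γ → (i : Fin Γ.length) → X (Γ.get i)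
  | _ :: _, a, ⟨0, _⟩ => a.1
  | _ :: _, a, ⟨i + 1, h⟩ => Tuple.get a.2 ⟨i, Nat.lt_of_succ_lt_succ h⟩

/-- Concatenation of tuples. -/
def Tuple.append {S : Type} {X : S → Type v} :
    {Γ Δ : List S} → Tuple X Γ → Tuple X Δ → Tuple X (Γ ++ Δ)
  | [], _, _, c => c
  | _ :: _, _, a, c => (a.1, Tuple.append a.2 c)

/-- Terms in variables `x_0, …, x_{n-1}` of sorts `Γ = [s_0, …, s_{n-1}]`. -/
inductive Term (L : MetricLanguage) (Γ : List L.Srt) : L.Srt → Type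
  | var (i : Fin Γ.length) : Term L Γ (Γ.get i)
  | app (f : L.Fn) (t : ∀ i, Term L Γ (L.fnDom f i)) : Term L Γ (L.fnCod f)

/-- The modulus that a term formally respects. -/
def Term.modulus {L : MetricLanguage} {Γ : List L.Srt} : {s : L.Srt} → Term L Γ s → (ℕ → ℝ≥0) → ℝ≥0
  | _, .var i, δ => δ i
  | _, .app f t, δ => (L.fnMod f).toFun fun i => (t i).modulus δ

/-- The value of a term. -/
def Term.eval {L : MetricLanguage} (M : MetricStructure.{v} L) {Γ : List L.Srt}
    (a : Tuple M.carrier Γ) : {s : L.Srt} → Term L Γ s → M.carrier s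
  | _, .var i => a.get i
  | _, .app f t => M.fn f fun i => (t i).eval M a

/-- Atomic formulas: distances between terms, and predicate symbols applied to terms. -/
inductive Atomic (L : MetricLanguage) (Γ : List L.Srt) : Type
  | dist (s : L.Srt) (t₁ t₂ : Term L Γ s) : Atomic L Γ
  | rel (R : L.Rel) (t : ∀ i, Term L Γ (L.relDom R i)) : Atomic L Γ

/-- The modulus that an atomic formula formally respects. -/
def Atomic.modulus {L : MetricLanguage} {Γ : List L.Srt} : Atomic L Γ → (ℕ → ℝ≥0) → ℝ≥0
  | .dist _ t₁ t₂, δ => t₁.modulus δ + t₂.modulus δ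
  | .rel R t, δ => (L.relMod R).toFun fun i => (t i).modulus δ

/-- The compact interval in which an atomic formula takes its values. -/
def Atomic.bound {L : MetricLanguage} {Γ : List L.Srt} : Atomic L Γ → Set ℝ
  | .dist s _ _ => Set.Icc 0 (L.diam s)
  | .rel R _ => Set.Icc (L.relLo R) (L.relHi R)

/-- The value of an atomic formula. -/
def Atomic.eval {L : MetricLanguage} (M : MetricStructure.{v} L) {Γ : List L.Srt}
    (a : Tuple M.carrier Γ) : Atomic L Γ → ℝ
  | .dist _ t₁ t₂ => Dist.dist (t₁.eval M a) (t₂.eval M a)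
  | .rel R t => M.rel R fun i => (t i).eval M a

/-- Basic formulas `f(φ_1, …, φ_k)`: the `φ_i` are atomic and the connective `f` is continuous on the
product of their bounds (its values elsewhere are irrelevant). -/
structure Basic (L : MetricLanguage) (Γ : List L.Srt) where
  k : ℕ
  atom : Fin k → Atomic L Γ
  f : (Fin k → ℝ) → ℝ
  continuousOn : ContinuousOn f (Set.univ.pi fun i => (atom i).bound)

/-- The modulus `Δ_f ∘ (Δ_{φ_1}, …, Δ_{φ_k})` that a basic formula formally respects, where
`Δ_f(η) = sup {|f x - f y| : |x_i - y_i| ≤ η_i for all i}`, the points `x, y` ranging over the product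
of the bounds of the `φ_i`. -/
noncomputable def Basic.modulus {L : MetricLanguage} {Γ : List L.Srt} (φ : Basic L Γ)
    (δ : ℕ → ℝ≥0) : ℝ≥0∞ :=
  ⨆ (x ∈ Set.univ.pi fun i => (φ.atom i).bound) (y ∈ Set.univ.pi fun i => (φ.atom i).bound)
    (_ : ∀ i, |x i - y i| ≤ (φ.atom i).modulus δ), edist (φ.f x) (φ.f y)

/-- A basic `Ω`-formula is a basic formula whose formal modulus is at most `Ω`. -/
def Basic.Respects {L : MetricLanguage} {Γ : List L.Srt} (φ : Basic L Γ) (Ω : WeakModulus) : Prop :=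
  ∀ δ, φ.modulus δ ≤ Ω.toFun δ

/-- The value of a basic formula. -/
def Basic.eval {L : MetricLanguage} (M : MetricStructure.{v} L) {Γ : List L.Srt}
    (a : Tuple M.carrier Γ) (φ : Basic L Γ) : ℝ :=
  φ.f fun i => (φ.atom i).eval M a

open Classical in
/-- The back-and-forth pseudo-distance `r_α(M a, N b)` of rank `α` with respect to `Ω`, with values in
`[0,∞]`. At each step a finite tuple (of any sorts) is played and answered by a tuple of the same
sorts. -/
noncomputable def bfDist {L : MetricLanguage} (Ω : WeakModulus) (M : MetricStructure.{v} L)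
    (N : MetricStructure.{v'} L) (α : Ordinal.{w}) (Γ : List L.Srt) (a : Tuple M.carrier Γ)
    (b : Tuple N.carrier Γ) : ℝ≥0∞ :=
  if α = 0 then
    ⨆ (φ : Basic L Γ) (_ : φ.Respects Ω), edist (φ.eval M a) (φ.eval N b)
  else
    (⨆ (β : Set.Iio α) (Δ : List L.Srt) (c : Tuple M.carrier Δ), ⨅ d : Tuple N.carrier Δ,
      bfDist Ω M N β.1 (Γ ++ Δ) (a.append c) (b.append d)) ⊔
    (⨆ (β : Set.Iio α) (Δ : List L.Srt) (d : Tuple N.carrier Δ), ⨅ c : Tuple M.carrier Δ,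
      bfDist Ω M N β.1 (Γ ++ Δ) (a.append c) (b.append d))
termination_by α
decreasing_by all_goals exact β.2

/-- `M ≡^{bf,Ω}_α N`. -/
def BFEquiv {L : MetricLanguage} (Ω : WeakModulus) (α : Ordinal.{w}) (M : MetricStructure.{v} L)
    (N : MetricStructure.{v'} L) : Prop :=
  bfDist Ω M N α [] PUnit.unit PUnit.unit = 0

/-- `M ≡^Ω_{∞,ω} N`: the relation `M ≡^{bf,Ω}_α N` holds for every ordinal `α`, countable or not
(i.e. `r_∞ = sup_α r_α` vanishes); `w` is the universe of the ordinals. -/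
def InftyEquiv {L : MetricLanguage} (Ω : WeakModulus) (M : MetricStructure.{v} L)
    (N : MetricStructure.{v'} L) : Prop :=
  ∀ α : Ordinal.{w}, BFEquiv Ω α M N

end ContLogic

namespace GroupOp

/-- The Hilbert space `ℓ²(G)`. -/
abbrev L2 (G : Type u) : Type u := lp (fun _ : G => ℂ) 2

/-- The operator on `ℓ²(G)` that permutes the coordinates: `(permOp σ ξ) h = ξ (σ⁻¹ h)`. -/
noncomputable def permOp {G : Type u} (σ : Equiv.Perm G) : L2 G →L[ℂ] L2 G :=
  LinearMap.mkContinuous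
    { toFun := fun ξ => ⟨fun h => ξ (σ.symm h), by
        have h := lp.memℓp ξ
        rw [memℓp_gen_iff (by norm_num)] at h
        exact memℓp_gen (σ.symm.summable_iff.2 h)⟩
      map_add' := fun _ _ => rfl
      map_smul' := fun _ _ => rfl } 1 fun ξ => by
    rw [lp.norm_eq_tsum_rpow (by norm_num), lp.norm_eq_tsum_rpow (by norm_num) ξ, one_mul]
    exact le_of_eq (congrArg (· ^ _) (σ.symm.tsum_eq fun h => ‖ξ h‖ ^ (2 : ℝ≥0∞).toReal))

@[simp] theorem permOp_apply {G : Type u} (σ : Equiv.Perm G) (ξ : L2 G) (h : G) :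
    permOp σ ξ h = ξ (σ.symm h) := rfl

/-- The left regular representation `g ↦ u_g`, `u_g δ_h = δ_{gh}`, that is,
`(u_g ξ) h = ξ (g⁻¹ h)`. -/
noncomputable def leftReg (G : Type u) [Group G] : G →* (L2 G →L[ℂ] L2 G) where
  toFun g := permOp (Equiv.mulLeft g)
  map_one' := by
    ext ξ h
    change ξ (1⁻¹ * h) = ξ h
    simp
  map_mul' a b := by
    ext ξ h
    change ξ ((a * b)⁻¹ * h) = ξ (b⁻¹ * (a⁻¹ * h))
    simp [mul_assoc]

/-- The extension `π : ℂ[G] → B(ℓ²(G))` of the left regular representation. -/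
noncomputable def leftRegAlg (G : Type u) [Group G] : MonoidAlgebra ℂ G →ₐ[ℂ] (L2 G →L[ℂ] L2 G) :=
  MonoidAlgebra.lift ℂ _ G (leftReg G)

theorem permOp_norm {G : Type u} (σ : Equiv.Perm G) (ξ : L2 G) : ‖permOp σ ξ‖ = ‖ξ‖ := by
  rw [lp.norm_eq_tsum_rpow (by norm_num), lp.norm_eq_tsum_rpow (by norm_num) ξ]
  exact congrArg (· ^ _) (σ.symm.tsum_eq fun h => ‖ξ h‖ ^ (2 : ℝ≥0∞).toReal)

theorem star_leftReg {G : Type u} [Group G] (g : G) : star (leftReg G g) = leftReg G g⁻¹ := by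
  rw [ContinuousLinearMap.star_eq_adjoint, eq_comm, ContinuousLinearMap.eq_adjoint_iff]
  intro ξ η
  rw [lp.inner_eq_tsum, lp.inner_eq_tsum, ← (Equiv.mulLeft g).tsum_eq (fun i => inner ℂ (ξ i) _)]
  refine tsum_congr fun h => ?_
  change inner ℂ (ξ (g⁻¹⁻¹ * h)) (η h) = inner ℂ (ξ (g * h)) (η (g⁻¹ * (g * h)))
  simp

/-- The image `π(ℂ[G])`, a `*`-subalgebra of `B(ℓ²(G))`. -/
noncomputable def groupAlg (G : Type u) [Group G] : StarSubalgebra ℂ (L2 G →L[ℂ] L2 G) where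
  __ := (leftRegAlg G).range
  star_mem' := by
    rintro _ ⟨x, rfl⟩
    induction x using MonoidAlgebra.induction_linear with
    | zero => exact ⟨0, by simp⟩
    | add f g hf hg =>
      obtain ⟨a, ha⟩ := hf
      obtain ⟨b, hb⟩ := hg
      exact ⟨a + b, by simp_all⟩
    | single a b =>
      exact ⟨MonoidAlgebra.single a⁻¹ (star b), by simp [leftRegAlg, star_leftReg]⟩

/-- The reduced group C*-algebra: the norm closure of `π(ℂ[G])`. -/
noncomputable def redCStar (G : Type u) [Group G] : StarSubalgebra ℂ (L2 G →L[ℂ] L2 G) :=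
  (groupAlg G).topologicalClosure

section sot

variable {H : Type u} [NormedAddCommGroup H] [InnerProductSpace ℂ H]

/-- The closure in the strong operator topology, i.e. the topology of pointwise convergence. -/
def sotClosure (S : Set (H →L[ℂ] H)) : Set (H →L[ℂ] H) :=
  ContinuousLinearMap.toPointwiseConvergenceCLM ℂ (RingHom.id ℂ) H H ⁻¹'
    closure (X := H →Lₚₜ[ℂ] H)
      (ContinuousLinearMap.toPointwiseConvergenceCLM ℂ (RingHom.id ℂ) H H '' S)

theorem subset_sotClosure (S : Set (H →L[ℂ] H)) : S ⊆ sotClosure S :=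
  fun _ h => subset_closure (X := H →Lₚₜ[ℂ] H) ⟨_, h, rfl⟩

theorem mem_sotClosure' {S : Set (H →L[ℂ] H)} {x : H →L[ℂ] H} :
    x ∈ sotClosure S ↔ (x : H → H) ∈ closure ((fun (a : H →L[ℂ] H) (ξ : H) => a ξ) '' S) := by
  have h := (PointwiseConvergenceCLM.isEmbedding_coeFn (RingHom.id ℂ) H H).closure_eq_preimage_closure_image
    (ContinuousLinearMap.toPointwiseConvergenceCLM ℂ (RingHom.id ℂ) H H '' S)
  rw [sotClosure, h, Set.image_image]
  rfl

theorem mem_sotClosure {S : Set (H →L[ℂ] H)} {x : H →L[ℂ] H} :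
    x ∈ sotClosure S ↔ ∀ (F : Finset H) (ε : ℝ), 0 < ε → ∃ a ∈ S, ∀ ξ ∈ F, ‖x ξ - a ξ‖ < ε := by
  rw [mem_sotClosure', mem_closure_iff]
  constructor
  · intro h F ε hε
    obtain ⟨_, hf, a, ha, rfl⟩ := h (⋂ ξ ∈ F, {f : H → H | ‖x ξ - f ξ‖ < ε})
      (isOpen_biInter_finset fun ξ _ => isOpen_lt (by fun_prop) continuous_const) (by simp [hε])
    exact ⟨a, ha, by simpa using hf⟩
  · intro h o ho hx
    obtain ⟨F, U, hU, hUo⟩ := isOpen_pi_iff.1 ho _ hx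
    have : ∀ᶠ ε : ℝ in nhdsWithin 0 (Set.Ioi 0), ∀ ξ ∈ F, Metric.ball (x ξ) ε ⊆ U ξ := by
      rw [Finset.eventually_all]
      intro ξ hξ
      obtain ⟨r, hr, h1⟩ := Metric.isOpen_iff.1 (hU ξ hξ).1 _ (hU ξ hξ).2
      filter_upwards [Ioo_mem_nhdsGT hr] with ε hε
      exact (Metric.ball_subset_ball hε.2.le).trans h1
    obtain ⟨ε, h1, hε⟩ := (this.and self_mem_nhdsWithin).exists
    obtain ⟨a, ha, h2⟩ := h F ε hε
    refine ⟨_, hUo fun ξ hξ => h1 ξ hξ ?_, a, ha, rfl⟩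
    rw [Metric.mem_ball, dist_comm, dist_eq_norm]
    exact h2 ξ hξ

/-- A pointwise closed condition that holds on `S` holds on its strong operator closure. -/
theorem sotClosure_induction {S : Set (H →L[ℂ] H)} {f g : (H → H) → H} (hf : Continuous f)
    (hg : Continuous g) (h : ∀ a ∈ S, f a = g a) {x : H →L[ℂ] H} (hx : x ∈ sotClosure S) :
    f x = g x := by
  refine closure_minimal (s := (fun (a : H →L[ℂ] H) (ξ : H) => a ξ) '' S) ?_ (isClosed_eq hf hg)
    (mem_sotClosure'.1 hx)
  rintro _ ⟨a, ha, rfl⟩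
  exact h a ha

theorem mul_mem_sotClosure (A : Subalgebra ℂ (H →L[ℂ] H)) {x y : H →L[ℂ] H}
    (hx : x ∈ sotClosure (A : Set (H →L[ℂ] H))) (hy : y ∈ sotClosure (A : Set (H →L[ℂ] H))) :
    x * y ∈ sotClosure (A : Set (H →L[ℂ] H)) := by
  classical
  rw [mem_sotClosure] at *
  intro F ε hε
  obtain ⟨a, ha, h1⟩ := hx (F.image y) (ε / 2) (by positivity)
  obtain ⟨b, hb, h2⟩ := hy F (ε / 2 / (‖a‖ + 1)) (by positivity)
  refine ⟨a * b, mul_mem ha hb, fun ξ hξ => ?_⟩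
  have h3 := h1 (y ξ) (Finset.mem_image_of_mem _ hξ)
  have h4 : ‖a (y ξ - b ξ)‖ < ε / 2 := by
    have := a.le_opNorm (y ξ - b ξ)
    have h5 := h2 ξ hξ
    rw [lt_div_iff₀ (by positivity)] at h5
    nlinarith [norm_nonneg (y ξ - b ξ)]
  calc ‖(x * y) ξ - (a * b) ξ‖ = ‖(x (y ξ) - a (y ξ)) + a (y ξ - b ξ)‖ := by simp
    _ ≤ _ := norm_add_le _ _
    _ < ε := by linarith

theorem add_mem_sotClosure (A : Subalgebra ℂ (H →L[ℂ] H)) {x y : H →L[ℂ] H}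
    (hx : x ∈ sotClosure (A : Set (H →L[ℂ] H))) (hy : y ∈ sotClosure (A : Set (H →L[ℂ] H))) :
    x + y ∈ sotClosure (A : Set (H →L[ℂ] H)) := by
  classical
  rw [mem_sotClosure] at *
  intro F ε hε
  obtain ⟨a, ha, h1⟩ := hx F (ε / 2) (by positivity)
  obtain ⟨b, hb, h2⟩ := hy F (ε / 2) (by positivity)
  refine ⟨a + b, add_mem ha hb, fun ξ hξ => ?_⟩
  calc ‖(x + y) ξ - (a + b) ξ‖ = ‖(x ξ - a ξ) + (y ξ - b ξ)‖ := by
        simp only [add_apply]; congr 1; abel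
    _ ≤ _ := norm_add_le _ _
    _ < ε := by linarith [h1 ξ hξ, h2 ξ hξ]

theorem star_mem_sotClosure [CompleteSpace H] (A : StarSubalgebra ℂ (H →L[ℂ] H)) {x : H →L[ℂ] H}
    (hx : x ∈ sotClosure (A : Set (H →L[ℂ] H))) : star x ∈ sotClosure (A : Set (H →L[ℂ] H)) := by
  classical
  rw [mem_sotClosure]
  intro F ε hε
  let T : (H →L[ℂ] H) →ₗ[ℂ] PiLp 2 (fun _ : F => H) :=
    { toFun := fun a => WithLp.toLp 2 fun ξ => a ξ
      map_add' := fun _ _ => rfl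
      map_smul' := fun _ _ => rfl }
  let V : Submodule ℂ (PiLp 2 (fun _ : F => H)) := (Subalgebra.toSubmodule A.toSubalgebra).map T
  have key : T (star x) ∈ Vᗮᗮ := by
    rw [Submodule.mem_orthogonal]
    intro η hη
    rw [Submodule.mem_orthogonal'] at hη
    have h0 : ∑ ξ : F, inner ℂ (x (η ξ)) (ξ : H) = 0 := by
      refine norm_le_zero_iff.1 (le_of_forall_pos_le_add fun ε hε => ?_)
      obtain ⟨a, ha, h1⟩ := mem_sotClosure.1 hx (Finset.univ.image fun ξ : F => η ξ)
        (ε / (∑ ξ : F, ‖(ξ : H)‖ + 1)) (by positivity)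
      have h2 : ∑ ξ : F, inner ℂ (a (η ξ)) (ξ : H) = 0 := by
        have := hη (T (star a)) ⟨star a, A.star_mem' ha, rfl⟩
        rw [PiLp.inner_apply] at this
        rw [← this]
        refine Finset.sum_congr rfl fun ξ _ => ?_
        exact (ContinuousLinearMap.adjoint_inner_right a (η ξ) (ξ : H)).symm
      have h3 : ∑ ξ : F, inner ℂ (x (η ξ)) (ξ : H) =
          ∑ ξ : F, inner ℂ (x (η ξ) - a (η ξ)) (ξ : H) := by
        simp only [inner_sub_left, Finset.sum_sub_distrib, h2, sub_zero]
      rw [h3, zero_add]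
      calc _ ≤ ∑ ξ : F, ‖inner ℂ (x (η ξ) - a (η ξ)) (ξ : H)‖ := norm_sum_le _ _
        _ ≤ ∑ ξ : F, (ε / (∑ ξ : F, ‖(ξ : H)‖ + 1)) * ‖(ξ : H)‖ := by
          refine Finset.sum_le_sum fun ξ _ => (norm_inner_le_norm _ _).trans ?_
          exact mul_le_mul_of_nonneg_right
            (h1 _ (Finset.mem_image_of_mem _ (Finset.mem_univ ξ))).le (norm_nonneg _)
        _ = ε * ((∑ ξ : F, ‖(ξ : H)‖) / (∑ ξ : F, ‖(ξ : H)‖ + 1)) := by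
          rw [← Finset.mul_sum]; ring
        _ ≤ ε := by
          refine mul_le_of_le_one_right hε.le ((div_le_one (by positivity)).2 (by linarith))
    rw [PiLp.inner_apply, ← h0]
    refine Finset.sum_congr rfl fun ξ _ => ?_
    exact ContinuousLinearMap.adjoint_inner_right x (η ξ) (ξ : H)
  rw [Submodule.orthogonal_orthogonal_eq_closure] at key
  obtain ⟨_, ⟨a, ha, rfl⟩, h⟩ := Metric.mem_closure_iff.1 key ε hε
  refine ⟨a, ha, fun ξ hξ => lt_of_le_of_lt ?_ h⟩
  rw [dist_eq_norm]
  exact PiLp.norm_apply_le (T (star x) - T a) (⟨ξ, hξ⟩ : F)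

/-- The strong operator closure of a `*`-subalgebra, as a `*`-subalgebra. -/
def sotStarSubalgebra [CompleteSpace H] (A : StarSubalgebra ℂ (H →L[ℂ] H)) :
    StarSubalgebra ℂ (H →L[ℂ] H) where
  carrier := sotClosure (A : Set (H →L[ℂ] H))
  mul_mem' := mul_mem_sotClosure A.toSubalgebra
  add_mem' := add_mem_sotClosure A.toSubalgebra
  algebraMap_mem' r := subset_sotClosure _ (A.algebraMap_mem' r)
  star_mem' := star_mem_sotClosure A

end sot

/-- The group von Neumann algebra `L(G)`: the closure of `π(ℂ[G])` in the strong operator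
topology. -/
noncomputable def groupVN (G : Type u) [Group G] : StarSubalgebra ℂ (L2 G →L[ℂ] L2 G) :=
  sotStarSubalgebra (groupAlg G)

open Classical in
/-- The basis vector `δ_g` of `ℓ²(G)`. -/
noncomputable def delta {G : Type u} (g : G) : L2 G := lp.single 2 g 1

/-- The trace `tr(x) = ⟨x δ_e, δ_e⟩` (Mathlib's inner product is linear in the second variable). -/
noncomputable def trace {G : Type u} [Group G] (x : L2 G →L[ℂ] L2 G) : ℂ :=
  inner ℂ (delta (1 : G)) (x (delta 1))

/-- The norm `‖x‖₂ = √(tr(x* x))`. -/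
noncomputable def twoNorm {G : Type u} [Group G] (x : L2 G →L[ℂ] L2 G) : ℝ :=
  √(trace (star x * x)).re

section twoNorm

variable {G : Type u}

theorem twoNorm_eq [Group G] (x : L2 G →L[ℂ] L2 G) : twoNorm x = ‖x (delta 1)‖ := by
  have : trace (star x * x) = inner ℂ (x (delta 1)) (x (delta 1)) :=
    ContinuousLinearMap.adjoint_inner_right x (delta 1) (x (delta 1))
  rw [twoNorm, this]
  exact (norm_eq_sqrt_re_inner (𝕜 := ℂ) _).symm

theorem norm_delta (g : G) : ‖delta g‖ = 1 := by
  classical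
  rw [delta, lp.norm_single (by norm_num)]; simp

theorem inner_delta (g : G) (ξ : L2 G) : inner ℂ (delta g) ξ = ξ g := by
  classical
  rw [delta, lp.inner_single_left]; simp

theorem permOp_delta (σ : Equiv.Perm G) (g : G) : permOp σ (delta g) = delta (σ g) := by
  classical
  ext h
  simp only [permOp_apply, delta, lp.single_apply, Pi.single_apply, Equiv.symm_apply_eq]

/-- Elements of `L(G)` commute with right translations. -/
theorem groupVN_comm [Group G] {x : L2 G →L[ℂ] L2 G} (hx : x ∈ groupVN G) (g : G) (ξ : L2 G) :
    x (permOp (Equiv.mulRight g) ξ) = permOp (Equiv.mulRight g) (x ξ) := by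
  refine sotClosure_induction (S := (groupAlg G : Set (L2 G →L[ℂ] L2 G)))
    (f := fun x => x (permOp (Equiv.mulRight g) ξ))
    (g := fun x => permOp (Equiv.mulRight g) (x ξ))
    (by fun_prop) (by fun_prop) ?_ hx
  rintro _ ⟨x, rfl⟩
  induction x using MonoidAlgebra.induction_linear with
  | zero => simp
  | add f g hf hg => simp_all
  | single a b =>
    ext h
    have : leftRegAlg G (MonoidAlgebra.single a b) = b • leftReg G a := by simp [leftRegAlg]
    change (leftRegAlg G (MonoidAlgebra.single a b)) _ h = (leftRegAlg G (MonoidAlgebra.single a b)) _ _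
    rw [this]
    change b * ξ (a⁻¹ * h * g⁻¹) = b * ξ (a⁻¹ * (h * g⁻¹))
    rw [mul_assoc]

theorem groupVN_delta [Group G] {x : L2 G →L[ℂ] L2 G} (hx : x ∈ groupVN G) (g : G) :
    x (delta g) = permOp (Equiv.mulRight g) (x (delta 1)) := by
  rw [← groupVN_comm hx, permOp_delta]; simp

theorem groupVN_norm_delta [Group G] {x : L2 G →L[ℂ] L2 G} (hx : x ∈ groupVN G) (g : G) :
    ‖x (delta g)‖ = twoNorm x := by
  rw [groupVN_delta hx, permOp_norm, twoNorm_eq]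

theorem twoNorm_star [Group G] {x : L2 G →L[ℂ] L2 G} (hx : x ∈ groupVN G) : twoNorm (star x) = twoNorm x := by
  rw [twoNorm_eq, twoNorm_eq, lp.norm_eq_tsum_rpow (by norm_num), lp.norm_eq_tsum_rpow (by norm_num),
    ← (Equiv.inv G).tsum_eq]
  congr 1
  refine tsum_congr fun g => ?_
  congr 1
  have : (star x (delta 1)) g⁻¹ = starRingEnd ℂ (x (delta 1) g) := by
    rw [← inner_delta g⁻¹, ContinuousLinearMap.star_eq_adjoint,
      ContinuousLinearMap.adjoint_inner_right, groupVN_delta hx, ← inner_conj_symm, inner_delta]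
    change starRingEnd ℂ (x (delta 1) (1 * g⁻¹⁻¹)) = _
    simp
  rw [Equiv.inv_apply, this, RCLike.norm_conj]

/-- The closed linear span of the `δ_g` is everything. -/
theorem delta_dense {P : L2 G → Prop} (hc : IsClosed {ξ | P ξ}) (h0 : P 0)
    (hadd : ∀ ξ η, P ξ → P η → P (ξ + η)) (hd : ∀ (c : ℂ) g, P (c • delta g)) (ξ : L2 G) : P ξ := by
  classical
  refine hc.mem_of_tendsto (lp.hasSum_single (by norm_num) ξ) (Filter.Eventually.of_forall fun s => ?_)
  refine Finset.sum_induction _ P hadd h0 fun g _ => ?_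
  convert hd (ξ g) g using 1
  rw [delta, ← lp.single_smul]; simp

theorem twoNorm_eq_zero [Group G] {x : L2 G →L[ℂ] L2 G} (hx : x ∈ groupVN G) (h : twoNorm x = 0) : x = 0 := by
  ext1 ξ
  refine delta_dense (P := fun ξ => x ξ = 0) (isClosed_eq (by fun_prop) (by fun_prop)) (by simp)
    (fun _ _ h1 h2 => by simp [h1, h2]) (fun c g => ?_) ξ
  rw [map_smul, norm_eq_zero.1 ((groupVN_norm_delta hx g).trans h), smul_zero]

end twoNorm

end GroupOp

namespace GroupOp

open ContLogic

/-- Function symbols for operator algebras, the sort `n : ℕ+` being the ball of radius `n`: constants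
`0, 1`, addition, multiplication, multiplication by each complex scalar, adjoint, and the inclusions
between balls. -/
inductive OpFn : Type
  | zero
  | one
  | add (m n : ℕ+)
  | mul (m n : ℕ+)
  | smul (c : ℂ) (m n : ℕ+) (h : ‖c‖ * m ≤ n)
  | star (n : ℕ+)
  | incl (m n : ℕ+) (h : m ≤ n)

/-- The arity of a function symbol. -/
def OpFn.arity : OpFn → ℕ
  | .zero => 0
  | .one => 0
  | .add _ _ => 2
  | .mul _ _ => 2
  | .smul _ _ _ _ => 1
  | .star _ => 1
  | .incl _ _ _ => 1

/-- The sorts of the arguments of a function symbol. -/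
def OpFn.dom : ∀ f : OpFn, Fin f.arity → ℕ+
  | .zero => ![]
  | .one => ![]
  | .add m n => ![m, n]
  | .mul m n => ![m, n]
  | .smul _ m _ _ => ![m]
  | .star n => ![n]
  | .incl m _ _ => ![m]

/-- The sort of the value of a function symbol. -/
def OpFn.cod : OpFn → ℕ+
  | .zero => 1
  | .one => 1
  | .add m n => m + n
  | .mul m n => m * n
  | .smul _ _ n _ => n
  | .star n => n
  | .incl _ n _ => n

/-- Lipschitz constants of a function symbol in each argument. -/
noncomputable def OpFn.coeff : ∀ f : OpFn, Fin f.arity → ℝ≥0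
  | .zero => ![]
  | .one => ![]
  | .add _ _ => ![1, 1]
  | .mul m n => ![(n : ℝ≥0), (m : ℝ≥0)]
  | .smul c _ _ _ => ![‖c‖₊]
  | .star _ => ![1]
  | .incl _ _ _ => ![1]

/-- The language with the sorts and function symbols above and, in addition, a family of unary
1-Lipschitz predicates, the predicate `R` being defined on the ball of radius `n = srt R` with values
in `[-n, n]`. -/
noncomputable def opLang (Rel : Type) (srt : Rel → ℕ+) : MetricLanguage where
  Srt := ℕ+
  diam n := 2 * n
  Fn := OpFn
  fnArity := OpFn.arity
  fnDom := OpFn.dom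
  fnCod := OpFn.cod
  fnMod f := Modulus.linear f.coeff
  Rel := Rel
  relArity _ := 1
  relDom R := ![srt R]
  relMod _ := Modulus.linear ![1]
  relLo R := -(srt R : ℝ)
  relHi R := (srt R : ℝ)

/-- The language of unital C*-algebras (no predicate besides the metric). -/
noncomputable def cstarLang : MetricLanguage := opLang Empty Empty.elim

/-- The predicate symbols for the real and imaginary part of the trace on each ball. -/
inductive TraceSym : Type
  | re (n : ℕ+)
  | im (n : ℕ+)

/-- The ball on which a trace symbol is defined. -/
def TraceSym.srt : TraceSym → ℕ+
  | .re n => n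
  | .im n => n

/-- The language of tracial von Neumann algebras. -/
noncomputable def tracialLang : MetricLanguage := opLang TraceSym TraceSym.srt

section structures

variable {H : Type u} [NormedAddCommGroup H] [InnerProductSpace ℂ H] [CompleteSpace H]

/-- The operator norm ball of radius `n` of a `*`-algebra of operators. -/
structure OpBall (A : StarSubalgebra ℂ (H →L[ℂ] H)) (n : ℕ+) : Type u where
  val : H →L[ℂ] H
  mem : val ∈ A
  norm_le : ‖val‖ ≤ n

theorem OpBall.ext' {A : StarSubalgebra ℂ (H →L[ℂ] H)} {n : ℕ+} {x y : OpBall A n}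
    (h : x.val = y.val) : x = y := by
  cases x; cases y; cases h; rfl

/-- The interpretation of the function symbols in the balls of `A`. -/
noncomputable def opFn (A : StarSubalgebra ℂ (H →L[ℂ] H)) :
    ∀ f : OpFn, (∀ i, OpBall A (f.dom i)) → OpBall A f.cod
  | .zero, _ => ⟨0, zero_mem A, by simp [OpFn.cod]⟩
  | .one, _ => ⟨1, one_mem A, by
      exact (ContinuousLinearMap.norm_id_le : ‖ContinuousLinearMap.id ℂ H‖ ≤ 1).trans_eq (by simp [OpFn.cod])⟩
  | .add m n, x =>
    let a : OpBall A m := x (0 : Fin 2)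
    let b : OpBall A n := x (1 : Fin 2)
    ⟨a.val + b.val, add_mem a.mem b.mem, by
      simpa [OpFn.cod] using (norm_add_le _ _).trans (add_le_add a.norm_le b.norm_le)⟩
  | .mul m n, x =>
    let a : OpBall A m := x (0 : Fin 2)
    let b : OpBall A n := x (1 : Fin 2)
    ⟨a.val * b.val, mul_mem a.mem b.mem, by
      simpa [OpFn.cod] using (norm_mul_le _ _).trans
        (mul_le_mul a.norm_le b.norm_le (norm_nonneg _) (by positivity))⟩
  | .smul c m n h, x =>
    let a : OpBall A m := x (0 : Fin 1)
    ⟨c • a.val, A.smul_mem a.mem c, by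
      rw [norm_smul]
      exact (mul_le_mul_of_nonneg_left a.norm_le (norm_nonneg _)).trans h⟩
  | .star n, x =>
    let a : OpBall A n := x (0 : Fin 1)
    ⟨star a.val, star_mem a.mem, by rw [norm_star]; exact a.norm_le⟩
  | .incl m n h, x =>
    let a : OpBall A m := x (0 : Fin 1)
    ⟨a.val, a.mem, a.norm_le.trans (by exact_mod_cast h)⟩

/-- The properties of a norm `p` on the operator algebra `A` which ensure that the balls of `A` with
the metric `p (x - y)` form a metric structure. -/
structure IsBallNorm (A : StarSubalgebra ℂ (H →L[ℂ] H)) (p : (H →L[ℂ] H) → ℝ) : Prop where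
  add_le : ∀ x y, p (x + y) ≤ p x + p y
  smul_eq : ∀ (c : ℂ) x, p (c • x) = ‖c‖ * p x
  le_norm : ∀ x, p x ≤ ‖x‖
  mul_le_left : ∀ x ∈ A, ∀ y ∈ A, p (x * y) ≤ ‖x‖ * p y
  mul_le_right : ∀ x ∈ A, ∀ y ∈ A, p (x * y) ≤ ‖y‖ * p x
  star_eq : ∀ x ∈ A, p (star x) = p x
  eq_zero : ∀ x ∈ A, p x = 0 → x = 0
  complete : ∀ (n : ℕ+) (x : ℕ → H →L[ℂ] H), (∀ k, x k ∈ A ∧ ‖x k‖ ≤ n) →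
    (∀ ε > 0, ∃ K, ∀ i ≥ K, ∀ j ≥ K, p (x i - x j) < ε) →
    ∃ y ∈ A, ‖y‖ ≤ n ∧ ∀ ε > 0, ∃ K, ∀ i ≥ K, p (x i - y) < ε

variable {A : StarSubalgebra ℂ (H →L[ℂ] H)} {p : (H →L[ℂ] H) → ℝ}

theorem IsBallNorm.zero (hp : IsBallNorm A p) : p 0 = 0 := by
  simpa using hp.smul_eq 0 0

theorem IsBallNorm.neg (hp : IsBallNorm A p) (x : H →L[ℂ] H) : p (-x) = p x := by
  simpa using hp.smul_eq (-1) x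

/-- The metric `p (x - y)` on the ball of radius `n`. -/
@[reducible]
noncomputable def IsBallNorm.metric (hp : IsBallNorm A p) (n : ℕ+) : MetricSpace (OpBall A n) where
  dist x y := p (x.val - y.val)
  dist_self x := by simp [hp.zero]
  dist_comm x y := by rw [← hp.neg, neg_sub]
  dist_triangle x y z := by
    rw [← sub_add_sub_cancel x.val y.val z.val]; exact hp.add_le _ _
  eq_of_dist_eq_zero {x y} h :=
    OpBall.ext' (sub_eq_zero.1 (hp.eq_zero _ (sub_mem x.mem y.mem) h))

theorem IsBallNorm.opFn_le (hp : IsBallNorm A p) (f : OpFn) (x y : ∀ i, OpBall A (f.dom i)) :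
    p ((opFn A f x).val - (opFn A f y).val) ≤ ∑ i, f.coeff i * p ((x i).val - (y i).val) := by
  cases f with
  | zero =>
    refine le_trans (le_of_eq ?_) (Fin.sum_univ_zero (M := ℝ) _).ge
    simp [opFn, hp.zero]
  | one =>
    refine le_trans (le_of_eq ?_) (Fin.sum_univ_zero (M := ℝ) _).ge
    simp [opFn, hp.zero]
  | add m n =>
    refine le_trans ?_ (Fin.sum_univ_two (M := ℝ) _).ge
    change p ((x (0 : Fin 2)).val + (x (1 : Fin 2)).val - ((y (0 : Fin 2)).val + (y (1 : Fin 2)).val)) ≤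
      ((1 : ℝ≥0) : ℝ) * _ + ((1 : ℝ≥0) : ℝ) * _
    rw [add_sub_add_comm, NNReal.coe_one, one_mul, one_mul]
    exact hp.add_le _ _
  | mul m n =>
    refine le_trans ?_ (Fin.sum_univ_two (M := ℝ) _).ge
    let a : OpBall A m := x (0 : Fin 2)
    let b : OpBall A n := x (1 : Fin 2)
    let a' : OpBall A m := y (0 : Fin 2)
    let b' : OpBall A n := y (1 : Fin 2)
    have hnn : ∀ z, 0 ≤ p z := fun z => by
      have := hp.add_le z (-z)
      rw [hp.neg, add_neg_cancel, hp.zero] at this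
      linarith
    change p (a.val * b.val - a'.val * b'.val) ≤ (((n : ℕ) : ℝ≥0) : ℝ) * p (a.val - a'.val) +
      (((m : ℕ) : ℝ≥0) : ℝ) * p (b.val - b'.val)
    have : a.val * b.val - a'.val * b'.val = (a.val - a'.val) * b.val + a'.val * (b.val - b'.val) := by
      noncomm_ring
    rw [this]
    refine (hp.add_le _ _).trans (add_le_add ?_ ?_)
    · refine (hp.mul_le_right _ (sub_mem a.mem a'.mem) _ b.mem).trans ?_
      exact mul_le_mul_of_nonneg_right (by simpa using b.norm_le) (hnn _)
    · refine (hp.mul_le_left _ a'.mem _ (sub_mem b.mem b'.mem)).trans ?_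
      exact mul_le_mul_of_nonneg_right (by simpa using a'.norm_le) (hnn _)
  | smul c m n h =>
    refine le_trans ?_ (Fin.sum_univ_one (M := ℝ) _).ge
    change p (c • (x (0 : Fin 1)).val - c • (y (0 : Fin 1)).val) ≤ ‖c‖ * _
    rw [← smul_sub, hp.smul_eq]
  | star n =>
    refine le_trans ?_ (Fin.sum_univ_one (M := ℝ) _).ge
    change p (star (x (0 : Fin 1)).val - star (y (0 : Fin 1)).val) ≤ ((1 : ℝ≥0) : ℝ) * _
    rw [← star_sub, hp.star_eq _ (sub_mem (x (0 : Fin 1)).mem (y (0 : Fin 1)).mem), NNReal.coe_one,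
      one_mul]
  | incl m n h =>
    refine le_trans ?_ (Fin.sum_univ_one (M := ℝ) _).ge
    change p ((x (0 : Fin 1)).val - (y (0 : Fin 1)).val) ≤ ((1 : ℝ≥0) : ℝ) * _
    rw [NNReal.coe_one, one_mul]

/-- The metric structure of an operator algebra `A` whose distinguished metric is `p (x - y)`, with
given interpretations of additional predicate symbols. -/
noncomputable def opStructure (hp : IsBallNorm A p) (Rel : Type) (srt : Rel → ℕ+)
    (rel : Rel → (H →L[ℂ] H) → ℝ) (hrel : ∀ R, ∀ x ∈ A, ∀ y ∈ A, |rel R x - rel R y| ≤ p (x - y))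
    (hrel0 : ∀ R x, |rel R x| ≤ ‖x‖) : MetricStructure (opLang Rel srt) where
  carrier n := OpBall A n
  metric n := hp.metric n
  complete n := by
    let _ := hp.metric n
    refine Metric.complete_of_cauchySeq_tendsto fun x hx => ?_
    obtain ⟨y, hy, hyn, h⟩ := hp.complete n (fun k => (x k).val) (fun k => ⟨(x k).mem, (x k).norm_le⟩)
      fun ε hε => by
        obtain ⟨K, hK⟩ := Metric.cauchySeq_iff.1 hx ε hε
        exact ⟨K, hK⟩
    exact ⟨⟨y, hy, hyn⟩, Metric.tendsto_atTop.2 h⟩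
  nndist_le (n : ℕ+) (x y : OpBall A n) := by
    have : p (x.val - y.val) ≤ 2 * (n : ℝ) := by
      have h1 := hp.le_norm (x.val - y.val)
      have h2 := norm_sub_le x.val y.val
      linarith [x.norm_le, y.norm_le]
    exact this
  fn := opFn A
  fn_obeys f x y := by
    let _ := fun n => hp.metric n
    rw [← NNReal.coe_le_coe]
    refine (hp.opFn_le f x y).trans (le_of_eq ?_)
    simp only [opLang, Modulus.linear, NNReal.coe_sum, NNReal.coe_mul]
    rfl
  rel R x := rel R (x (0 : Fin 1)).val
  rel_obeys R x y := by
    let _ := fun n => hp.metric n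
    rw [← NNReal.coe_le_coe]
    refine (hrel R _ (x (0 : Fin 1)).mem _ (y (0 : Fin 1)).mem).trans (le_of_eq ?_)
    have h (d : Fin 1 → ℝ≥0) : (d 0 : ℝ) = ((Modulus.linear ![1]).toFun d : ℝ≥0) := by
      simp [Modulus.linear]
    exact h fun i => nndist (α := OpBall A (![srt R] i)) (x i) (y i)
  rel_mem R x := abs_le.1 ((hrel0 R _).trans (x (0 : Fin 1)).norm_le)

end structures

theorem redCStar_isBallNorm (G : Type u) [Group G] : IsBallNorm (redCStar G) norm where
  add_le := norm_add_le
  smul_eq := norm_smul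
  le_norm _ := le_rfl
  mul_le_left x _ y _ := norm_mul_le x y
  mul_le_right x _ y _ := (norm_mul_le x y).trans_eq (mul_comm _ _)
  star_eq x _ := norm_star x
  eq_zero _ _ := norm_eq_zero.1
  complete n x hx hc := by
    have : CauchySeq x := Metric.cauchySeq_iff.2 fun ε hε => by simpa only [dist_eq_norm] using hc ε hε
    obtain ⟨y, hy⟩ := cauchySeq_tendsto_of_complete this
    refine ⟨y, (StarSubalgebra.isClosed_topologicalClosure _).mem_of_tendsto hy
      (Filter.Eventually.of_forall fun k => (hx k).1), le_of_tendsto hy.norm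
      (Filter.Eventually.of_forall fun k => (hx k).2), ?_⟩
    simpa only [dist_eq_norm] using Metric.tendsto_atTop.1 hy

theorem twoNorm_le {G : Type u} [Group G] (x : L2 G →L[ℂ] L2 G) : twoNorm x ≤ ‖x‖ := by
  simpa [twoNorm_eq, norm_delta] using x.le_opNorm (delta 1)

theorem groupVN_complete {G : Type u} [Group G] (n : ℕ+) (x : ℕ → L2 G →L[ℂ] L2 G)
    (hx : ∀ k, x k ∈ groupVN G ∧ ‖x k‖ ≤ n)
    (hc : ∀ ε > 0, ∃ K, ∀ i ≥ K, ∀ j ≥ K, twoNorm (x i - x j) < ε) :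
    ∃ y ∈ groupVN G, ‖y‖ ≤ n ∧ ∀ ε > 0, ∃ K, ∀ i ≥ K, twoNorm (x i - y) < ε := by
  have hn : ∀ k ξ, ‖x k ξ‖ ≤ n * ‖ξ‖ := fun k ξ => (x k).le_of_opNorm_le (hx k).2 ξ
  have hn0 : (0 : ℝ) < n := by exact_mod_cast n.pos
  have hC : ∀ ξ, CauchySeq fun k => x k ξ := by
    refine delta_dense (P := fun ξ => CauchySeq fun k => x k ξ) ?_ ?_ ?_ ?_
    · refine isClosed_of_closure_subset fun ξ hξ => Metric.cauchySeq_iff.2 fun ε hε => ?_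
      obtain ⟨η, hη, hd⟩ := Metric.mem_closure_iff.1 hξ (ε / 3 / n) (by positivity)
      obtain ⟨K, hK⟩ := Metric.cauchySeq_iff.1 hη (ε / 3) (by positivity)
      refine ⟨K, fun i hi j hj => ?_⟩
      have h1 : ∀ k, dist (x k ξ) (x k η) < ε / 3 := fun k => by
        rw [dist_eq_norm, ← map_sub]
        refine (hn k _).trans_lt ?_
        rw [dist_eq_norm, lt_div_iff₀ hn0] at hd
        linarith
      have h2 := dist_triangle4 (x i ξ) (x i η) (x j η) (x j ξ)
      have h3 := h1 j
      rw [dist_comm] at h3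
      linarith [h1 i, hK i hi j hj]
    · simpa using cauchySeq_const (0 : L2 G)
    · intro ξ η h1 h2
      simp only [map_add]
      exact h1.add h2
    · intro c g
      have : CauchySeq fun k => x k (delta g) := Metric.cauchySeq_iff.2 fun ε hε => by
        obtain ⟨K, hK⟩ := hc ε hε
        refine ⟨K, fun i hi j hj => ?_⟩
        have := hK i hi j hj
        rwa [← groupVN_norm_delta (sub_mem (hx i).1 (hx j).1) g, sub_apply,
          ← dist_eq_norm] at this
      simp only [map_smul]
      exact (uniformContinuous_const_smul c).comp_cauchySeq this
  choose f hf using fun ξ => cauchySeq_tendsto_of_complete (hC ξ)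
  let y := ContinuousLinearMap.ofTendstoOfBoundedRange (l := Filter.atTop) f x (tendsto_pi_nhds.2 hf)
    (isBounded_iff_forall_norm_le.2 ⟨n, by rintro _ ⟨k, rfl⟩; exact (hx k).2⟩)
  refine ⟨y, ?_, ?_, ?_⟩
  · refine mem_sotClosure'.2 (isClosed_closure.mem_of_tendsto (tendsto_pi_nhds.2 hf)
      (Filter.Eventually.of_forall fun k => mem_sotClosure'.1 (hx k).1))
  · exact y.opNorm_le_bound hn0.le fun ξ =>
      le_of_tendsto (hf ξ).norm (Filter.Eventually.of_forall fun k => hn k ξ)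
  · have h1 := Metric.tendsto_atTop.1 (hf (delta 1))
    intro ε hε
    obtain ⟨K, hK⟩ := h1 ε hε
    refine ⟨K, fun i hi => ?_⟩
    rw [twoNorm_eq]
    have := hK i hi
    rwa [dist_eq_norm] at this

theorem groupVN_isBallNorm (G : Type u) [Group G] : IsBallNorm (groupVN G) twoNorm where
  add_le x y := by simp only [twoNorm_eq]; exact norm_add_le (x (delta 1)) (y (delta 1))
  smul_eq c x := by simp only [twoNorm_eq]; exact norm_smul c (x (delta 1))
  le_norm := twoNorm_le
  mul_le_left x _ y _ := by simp only [twoNorm_eq]; exact x.le_opNorm (y (delta 1))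
  mul_le_right x hx y hy := by
    rw [← twoNorm_star (mul_mem hx hy), ← twoNorm_star hx, ← norm_star y, star_mul]
    simp only [twoNorm_eq]
    exact (star y).le_opNorm (star x (delta 1))
  star_eq _ hx := twoNorm_star hx
  eq_zero _ := twoNorm_eq_zero
  complete := groupVN_complete

theorem norm_trace_le {G : Type u} [Group G] (x : L2 G →L[ℂ] L2 G) : ‖trace x‖ ≤ twoNorm x := by
  have := norm_inner_le_norm (𝕜 := ℂ) (delta (1 : G)) (x (delta 1))
  rwa [norm_delta, one_mul, ← twoNorm_eq] at this

theorem trace_sub {G : Type u} [Group G] (x y : L2 G →L[ℂ] L2 G) :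
    trace (x - y) = trace x - trace y := by
  simp [trace]

/-- The interpretation of the trace symbols. -/
noncomputable def traceRel (G : Type u) [Group G] : TraceSym → (L2 G →L[ℂ] L2 G) → ℝ
  | .re _, x => (trace x).re
  | .im _, x => (trace x).im

/-- `L(G)` as a metric structure in the language of tracial von Neumann algebras: sorts are the
operator norm balls of integer radius, the metric is `‖x - y‖₂`. -/
noncomputable def vnStructure (G : Type u) [Group G] : MetricStructure.{u} tracialLang :=
  opStructure (groupVN_isBallNorm G) TraceSym TraceSym.srt (traceRel G)
    (fun R x _ y _ => by
      refine le_trans ?_ (norm_trace_le (x - y))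
      rw [trace_sub]
      cases R with
      | re n => simpa [traceRel] using Complex.abs_re_le_norm (trace x - trace y)
      | im n => simpa [traceRel] using Complex.abs_im_le_norm (trace x - trace y))
    (fun R x => by
      refine le_trans ?_ ((norm_trace_le x).trans (twoNorm_le x))
      cases R with
      | re n => exact Complex.abs_re_le_norm (trace x)
      | im n => exact Complex.abs_im_le_norm (trace x))

/-- `C*_r(G)` as a metric structure in the language of C*-algebras: sorts are the balls of integer
radius, the metric is that of the operator norm. -/
noncomputable def cstarStructure (G : Type u) [Group G] : MetricStructure.{u} cstarLang :=
  opStructure (redCStar_isBallNorm G) Empty Empty.elim (fun R => R.elim) (fun R => R.elim)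
    (fun R => R.elim)

end GroupOp

/-- The free group `F_κ` of rank `κ`. -/
abbrev FreeGroupOfRank (κ : Cardinal.{u}) : Type u := FreeGroup κ.out

/-! A bijection between finite sets of generators of the two free groups is a pair of injections of
one finite set `X`, and it embeds the free group on `X` into both. An element `y` of its group
algebra then acts on both `ℓ²` spaces, and the operator norm, the trace and the 2-norm of the two
operators depend only on `y` (`norm_regMap`, `trace_regMap`, `twoNorm_regMap`). Hence tuples with
the same expressions in matched generators satisfy the same atomic formulas.

Such matchings form an approximate back-and-forth system. Any element of a ball is a limit of group
algebra elements of the same ball; each of these involves finitely many generators, and the matching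
extends to them because the other set of generators is infinite (`FinMatch.exists_extension`,
`FinMatch.forth`). A move can thus be answered exactly after an arbitrarily small perturbation. By
`bfDist_le_add` and `WeakModulus.exists_pos_lt` the perturbation costs arbitrarily little, so
induction on the rank gives distance zero for every ordinal (`bfDist_eq_zero`).

Two analytic facts carry this. An injection `K → G` is isometric for the reduced norms because
`ℓ²(G)` splits along the cosets of `K` into copies of `ℓ²(K)`. The balls of `L(G)` are the 2-norm
closures of the corresponding balls of the group algebra, a form of Kaplansky's density theorem;
here it follows from Hahn–Banach separation and a trace inequality (`exists_re_inner_le`). -/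

namespace ContLogic

/-! ### Related tuples and the continuity of the back-and-forth distance. -/

/-- Two tuples are related if their corresponding entries are. -/
def Tuple.Rel {S : Type} {X : S → Type v} {Y : S → Type v'} (r : ∀ s, X s → Y s → Prop) :
    ∀ {Γ : List S}, Tuple X Γ → Tuple Y Γ → Prop
  | [], _, _ => True
  | s :: _, a, b => r s a.1 b.1 ∧ Tuple.Rel r a.2 b.2

section Rel

variable {S : Type} {X : S → Type v} {Y : S → Type v'} {r r' : ∀ s, X s → Y s → Prop}

theorem Tuple.Rel.mono (h : ∀ s x y, r s x y → r' s x y) :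
    ∀ {Γ : List S} {a : Tuple X Γ} {b : Tuple Y Γ}, Tuple.Rel r a b → Tuple.Rel r' a b
  | [], _, _, _ => trivial
  | s :: _, _, _, hab => ⟨h s _ _ hab.1, hab.2.mono h⟩

theorem Tuple.Rel.swap : ∀ {Γ : List S} {a : Tuple X Γ} {b : Tuple Y Γ}, Tuple.Rel r a b →
    Tuple.Rel (fun s y x => r s x y) b a
  | [], _, _, _ => trivial
  | _ :: _, _, _, hab => ⟨hab.1, hab.2.swap⟩

theorem Tuple.Rel.append {Δ : List S} {c : Tuple X Δ} {d : Tuple Y Δ} (hcd : Tuple.Rel r c d) :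
    ∀ {Γ : List S} {a : Tuple X Γ} {b : Tuple Y Γ}, Tuple.Rel r a b →
      Tuple.Rel r (a.append c) (b.append d)
  | [], _, _, _ => hcd
  | _ :: _, _, _, hab => ⟨hab.1, hcd.append hab.2⟩

theorem Tuple.Rel.get : ∀ {Γ : List S} {a : Tuple X Γ} {b : Tuple Y Γ}, Tuple.Rel r a b →
    ∀ i : Fin Γ.length, r _ (a.get i) (b.get i)
  | _ :: _, _, _, hab, ⟨0, _⟩ => hab.1
  | _ :: _, _, _, hab, ⟨i + 1, h⟩ => hab.2.get ⟨i, Nat.lt_of_succ_lt_succ h⟩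

theorem Tuple.Rel.refl {r : ∀ s, X s → X s → Prop} (h : ∀ s x, r s x x) :
    ∀ {Γ : List S} (a : Tuple X Γ), Tuple.Rel r a a
  | [], _ => trivial
  | s :: _, a => ⟨h s a.1, .refl h a.2⟩

end Rel

variable {L : MetricLanguage} {M : MetricStructure.{v} L} {N : MetricStructure.{v'} L}
  {Ω : WeakModulus}

/-- The sequence of distances between the entries of two tuples, continued by zeros. -/
noncomputable def Tuple.nndists : ∀ {Γ : List L.Srt}, Tuple M.carrier Γ → Tuple M.carrier Γ → ℕ → ℝ≥0
  | [], _, _, _ => 0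
  | _ :: _, a, b, 0 => nndist a.1 b.1
  | _ :: _, a, b, n + 1 => Tuple.nndists a.2 b.2 n

theorem Tuple.nndists_get : ∀ {Γ : List L.Srt} (a b : Tuple M.carrier Γ) (i : Fin Γ.length),
    a.nndists b i = nndist (a.get i) (b.get i)
  | _ :: _, _, _, ⟨0, _⟩ => rfl
  | _ :: _, a, b, ⟨i + 1, h⟩ => Tuple.nndists_get a.2 b.2 ⟨i, Nat.lt_of_succ_lt_succ h⟩

theorem Tuple.nndists_self : ∀ {Γ : List L.Srt} (a : Tuple M.carrier Γ) (n : ℕ), a.nndists a n = 0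
  | [], _, _ => rfl
  | _ :: _, a, 0 => nndist_self a.1
  | _ :: _, a, n + 1 => Tuple.nndists_self a.2 n

theorem Tuple.nndists_append {Δ : List L.Srt} (c : Tuple M.carrier Δ) :
    ∀ {Γ : List L.Srt} (a b : Tuple M.carrier Γ) (n : ℕ),
      (a.append c).nndists (b.append c) n = a.nndists b n
  | [], _, _, n => Tuple.nndists_self c n
  | _ :: _, _, _, 0 => rfl
  | _ :: _, a, b, n + 1 => Tuple.nndists_append c a.2 b.2 n

theorem Tuple.Rel.nndists_le {ε : ℝ≥0} : ∀ {Γ : List L.Srt} {a b : Tuple M.carrier Γ},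
    Tuple.Rel (fun _ x y => nndist x y ≤ ε) a b → ∀ n, a.nndists b n ≤ if n < Γ.length then ε else 0
  | [], _, _, _, _ => by simp [Tuple.nndists]
  | _ :: _, _, _, h, 0 => by simpa [Tuple.nndists] using h.1
  | _ :: _, _, _, h, n + 1 => by simpa [Tuple.nndists] using h.2.nndists_le n

theorem Term.nndist_eval_le {Γ : List L.Srt} (a b : Tuple M.carrier Γ) {s : L.Srt} (t : Term L Γ s) :
    nndist (t.eval M a) (t.eval M b) ≤ t.modulus (a.nndists b) := by
  induction t with
  | var i => exact (Tuple.nndists_get a b i).ge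
  | app f t ih => exact (M.fn_obeys f _ _).trans ((L.fnMod f).mono ih)

theorem Atomic.dist_eval_le {Γ : List L.Srt} (a b : Tuple M.carrier Γ) (φ : Atomic L Γ) :
    |φ.eval M a - φ.eval M b| ≤ φ.modulus (a.nndists b) := by
  cases φ with
  | dist s t₁ t₂ =>
    refine (dist_dist_dist_le _ _ _ _).trans ?_
    exact add_le_add (t₁.nndist_eval_le a b) (t₂.nndist_eval_le a b)
  | rel R t => exact (M.rel_obeys R _ _).trans ((L.relMod R).mono fun i => (t i).nndist_eval_le a b)

theorem Atomic.eval_mem {Γ : List L.Srt} (a : Tuple M.carrier Γ) (φ : Atomic L Γ) :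
    φ.eval M a ∈ φ.bound := by
  cases φ with
  | dist s t₁ t₂ => exact ⟨dist_nonneg, M.nndist_le s _ _⟩
  | rel R t => exact M.rel_mem R _

/-- The two vectors of atomic values lie in the bounds and differ coordinatewise by at most the
atomic moduli, so they are one of the pairs in the supremum that defines `φ.modulus`. -/
theorem Basic.edist_eval_le {Γ : List L.Srt} (a b : Tuple M.carrier Γ) {φ : Basic L Γ}
    (hφ : φ.Respects Ω) : edist (φ.eval M a) (φ.eval M b) ≤ Ω.toFun (a.nndists b) := by
  refine le_trans ?_ (hφ _)
  exact le_iSup₂_of_le _ (fun i _ => (φ.atom i).eval_mem a) <|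
    le_iSup₂_of_le _ (fun i _ => (φ.atom i).eval_mem b) <|
    le_iSup_of_le (fun i => (φ.atom i).dist_eval_le a b) le_rfl

theorem bfDist_zero {Γ : List L.Srt} (a : Tuple M.carrier Γ) (b : Tuple N.carrier Γ) :
    bfDist Ω M N (0 : Ordinal.{w}) Γ a b =
      ⨆ (φ : Basic L Γ) (_ : φ.Respects Ω), edist (φ.eval M a) (φ.eval N b) := by
  rw [bfDist, if_pos rfl]

theorem bfDist_of_ne_zero {α : Ordinal.{w}} (hα : α ≠ 0) {Γ : List L.Srt} (a : Tuple M.carrier Γ)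
    (b : Tuple N.carrier Γ) : bfDist Ω M N α Γ a b =
      (⨆ (β : Set.Iio α) (Δ : List L.Srt) (c : Tuple M.carrier Δ), ⨅ d : Tuple N.carrier Δ,
        bfDist Ω M N β.1 (Γ ++ Δ) (a.append c) (b.append d)) ⊔
      (⨆ (β : Set.Iio α) (Δ : List L.Srt) (d : Tuple N.carrier Δ), ⨅ c : Tuple M.carrier Δ,
        bfDist Ω M N β.1 (Γ ++ Δ) (a.append c) (b.append d)) := by
  rw [bfDist, if_neg hα]

theorem bfDist_comm (α : Ordinal.{w}) (Γ : List L.Srt) (a : Tuple M.carrier Γ)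
    (b : Tuple N.carrier Γ) : bfDist Ω M N α Γ a b = bfDist Ω N M α Γ b a := by
  induction α using WellFoundedLT.induction generalizing Γ with
  | ind α ih =>
    by_cases hα : α = 0
    · subst hα
      simp only [bfDist_zero, edist_comm]
    · rw [bfDist_of_ne_zero hα, bfDist_of_ne_zero hα, sup_comm]
      simp only [fun (β : Set.Iio α) Γ a b => ih β.1 β.2 Γ a b]

/-- This is what makes approximate answers sufficient. The error term does not grow during the game:
both `a` and `a'` are extended by the same tuple, whose entries contribute zero distances. -/
theorem bfDist_le_add (α : Ordinal.{w}) (Γ : List L.Srt) (a a' : Tuple M.carrier Γ)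
    (b : Tuple N.carrier Γ) :
    bfDist Ω M N α Γ a b ≤ Ω.toFun (a.nndists a') + bfDist Ω M N α Γ a' b := by
  induction α using WellFoundedLT.induction generalizing Γ with
  | ind α ih =>
    by_cases hα : α = 0
    · subst hα
      simp only [bfDist_zero]
      refine iSup₂_le fun φ hφ => (edist_triangle _ (φ.eval M a') _).trans ?_
      exact add_le_add (φ.edist_eval_le a a' hφ) (le_iSup₂_of_le φ hφ le_rfl)
    · have key : ∀ (β : Set.Iio α) (Δ : List L.Srt) (c : Tuple M.carrier Δ) (d : Tuple N.carrier Δ),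
          bfDist Ω M N β.1 (Γ ++ Δ) (a.append c) (b.append d) ≤ Ω.toFun (a.nndists a') +
            bfDist Ω M N β.1 (Γ ++ Δ) (a'.append c) (b.append d) := fun β Δ c d => by
        refine (ih β.1 β.2 _ _ (a'.append c) _).trans ?_
        rw [funext fun n => Tuple.nndists_append c a a' n]
      rw [bfDist_of_ne_zero hα, bfDist_of_ne_zero hα]
      refine sup_le (iSup_le fun β => iSup₂_le fun Δ c => ?_) (iSup_le fun β => iSup₂_le fun Δ d => ?_)
      · refine le_trans ?_ (add_le_add_right (le_sup_of_le_left
          (le_iSup_of_le β (le_iSup₂_of_le Δ c le_rfl))) _)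
        rw [ENNReal.add_iInf]
        exact iInf_mono fun d => key β Δ c d
      · refine le_trans ?_ (add_le_add_right (le_sup_of_le_right
          (le_iSup_of_le β (le_iSup₂_of_le Δ d le_rfl))) _)
        rw [ENNReal.add_iInf]
        exact iInf_mono fun c => key β Δ c d

/-- A weak modulus is small at small vectors with a bounded number of nonzero entries. -/
theorem WeakModulus.exists_pos_lt (Ω : WeakModulus) (n : ℕ) {η : ℝ≥0∞} (hη : 0 < η) :
    ∃ ε : ℝ≥0, 0 < ε ∧ Ω.toFun (fun i => if i < n then ε else 0) < η := by
  induction n generalizing η with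
  | zero => exact ⟨1, one_pos, by simpa [← Pi.zero_def, Ω.map_zero] using hη⟩
  | succ n ih =>
    obtain ⟨ε₁, h₁, h₁'⟩ := ih (ENNReal.half_pos hη.ne')
    -- Separate continuity controls the new coordinate alone; subadditivity then splits the vector
    -- into its first `n` entries and this coordinate.
    have h := (Ω.continuous_update 0 n).tendsto 0
    rw [show Function.update (0 : ℕ → ℝ≥0) n 0 = 0 from Function.update_eq_self n 0, Ω.map_zero] at h
    obtain ⟨ε₂, h₂, h₂'⟩ := ((h.mono_left (nhdsWithin_le_nhds (s := Set.Ioi 0))).eventually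
      (gt_mem_nhds (ENNReal.half_pos hη.ne')) |>.and self_mem_nhdsWithin).exists
    refine ⟨min ε₁ ε₂, lt_min h₁ h₂', ?_⟩
    calc _ ≤ Ω.toFun ((fun i => if i < n then ε₁ else 0) + Function.update (0 : ℕ → ℝ≥0) n ε₂) :=
          Ω.mono fun i => by
            rcases lt_trichotomy i n with h | rfl | h
            · simp [h, h.ne, Nat.lt_succ_of_lt h]
            · simp
            · simp [not_lt.2 h.le, h.ne', not_lt.2 (Nat.succ_le_of_lt h)]
      _ ≤ _ := Ω.subadd _ _
      _ < η / 2 + η / 2 := ENNReal.add_lt_add h₁' h₂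
      _ = η := ENNReal.add_halves η

/-! ### Approximate back-and-forth systems. -/

section system

variable {P : Type*} {r : P → ∀ s, M.carrier s → N.carrier s → Prop}

/-- A one-element forth property up to `ε` implies the same property for finite tuples. -/
theorem exists_tuple_of_forth
    (forth : ∀ p s (c : M.carrier s) (ε : ℝ≥0), 0 < ε → ∃ p', (∀ t x y, r p t x y → r p' t x y) ∧
      ∃ c' d, r p' s c' d ∧ nndist c c' ≤ ε) {ε : ℝ≥0} (hε : 0 < ε) :
    ∀ (Δ : List L.Srt) (p : P) (c : Tuple M.carrier Δ), ∃ p', (∀ t x y, r p t x y → r p' t x y) ∧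
      ∃ (c' : Tuple M.carrier Δ) (d : Tuple N.carrier Δ), Tuple.Rel (r p') c' d ∧
        Tuple.Rel (fun _ x y => nndist x y ≤ ε) c c'
  | [], p, _ => ⟨p, fun _ _ _ h => h, PUnit.unit, PUnit.unit, trivial, trivial⟩
  | s :: Δ, p, c => by
    obtain ⟨p₁, h₁, x, y, hxy, hx⟩ := forth p s c.1 ε hε
    obtain ⟨p₂, h₂, c', d, hcd, hc⟩ := exists_tuple_of_forth forth hε Δ p₁ c.2
    exact ⟨p₂, fun t x y h => h₂ t x y (h₁ t x y h), (x, c'), (y, d), ⟨h₂ _ _ _ hxy, hcd⟩, hx, hc⟩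

/-- The move `c` is replaced by a nearby `c'` that has an exact partner `d`. The distance for `c'`
and `d` vanishes, and passing from `c` to `c'` costs less than `η` once `ε` is chosen according to
the total length of the tuples. -/
theorem iInf_bfDist_eq_zero
    (forth : ∀ p s (c : M.carrier s) (ε : ℝ≥0), 0 < ε → ∃ p', (∀ t x y, r p t x y → r p' t x y) ∧
      ∃ c' d, r p' s c' d ∧ nndist c c' ≤ ε) {β : Ordinal.{w}}
    (h0 : ∀ p Γ (a : Tuple M.carrier Γ) (b : Tuple N.carrier Γ), Tuple.Rel (r p) a b →
      bfDist Ω M N β Γ a b = 0)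
    {p : P} {Γ : List L.Srt} {a : Tuple M.carrier Γ} {b : Tuple N.carrier Γ}
    (hab : Tuple.Rel (r p) a b) {Δ : List L.Srt} (c : Tuple M.carrier Δ) :
    ⨅ d : Tuple N.carrier Δ, bfDist Ω M N β (Γ ++ Δ) (a.append c) (b.append d) = 0 := by
  refine nonpos_iff_eq_zero.1 (le_of_forall_gt fun η hη => ?_)
  obtain ⟨ε, hε, h⟩ := Ω.exists_pos_lt (Γ ++ Δ).length hη
  obtain ⟨p', hp, c', d, hcd, hc⟩ := exists_tuple_of_forth forth hε Δ p c
  refine (iInf_le _ d).trans_lt ((bfDist_le_add β _ _ (a.append c') _).trans_lt ?_)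
  rw [h0 p' _ _ _ (hcd.append (hab.mono hp)), add_zero]
  refine (Ω.mono fun n => Tuple.Rel.nndists_le (hc.append (Tuple.Rel.refl (fun s x => ?_) a)) n).trans_lt h
  simp

/-- A system of relations with the approximate back-and-forth property that preserves atomic
formulas only relates tuples at back-and-forth distance zero. -/
theorem bfDist_eq_zero
    (atomic : ∀ p Γ (a : Tuple M.carrier Γ) (b : Tuple N.carrier Γ), Tuple.Rel (r p) a b →
      ∀ φ : Atomic L Γ, φ.eval M a = φ.eval N b)
    (forth : ∀ p s (c : M.carrier s) (ε : ℝ≥0), 0 < ε → ∃ p', (∀ t x y, r p t x y → r p' t x y) ∧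
      ∃ c' d, r p' s c' d ∧ nndist c c' ≤ ε)
    (back : ∀ p s (d : N.carrier s) (ε : ℝ≥0), 0 < ε → ∃ p', (∀ t x y, r p t x y → r p' t x y) ∧
      ∃ d' c, r p' s c d' ∧ nndist d d' ≤ ε)
    (α : Ordinal.{w}) (p : P) (Γ : List L.Srt) (a : Tuple M.carrier Γ) (b : Tuple N.carrier Γ)
    (hab : Tuple.Rel (r p) a b) : bfDist Ω M N α Γ a b = 0 := by
  induction α using WellFoundedLT.induction generalizing p Γ with
  | ind α ih =>
    by_cases hα : α = 0
    · subst hα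
      rw [bfDist_zero]
      -- At rank zero every basic formula has the same atomic arguments on both sides.
      simp only [Basic.eval, atomic p Γ a b hab, edist_self]
      simp
    · rw [bfDist_of_ne_zero hα]
      refine le_antisymm (sup_le (iSup_le fun β => iSup₂_le fun Δ c => ?_)
        (iSup_le fun β => iSup₂_le fun Δ d => ?_)) bot_le
      · exact (iInf_bfDist_eq_zero forth (ih β.1 β.2) hab c).le
      -- By symmetry of the distance, the second half is the first half for the reversed relations.
      · simp only [bfDist_comm (M := M)]
        exact (iInf_bfDist_eq_zero (r := fun p s y x => r p s x y)
          (fun p s d ε hε => (back p s d ε hε).imp fun _ h => ⟨fun t y x => h.1 t x y, h.2⟩)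
          (fun p Γ b a h => (bfDist_comm _ _ _ _).trans (ih β.1 β.2 p Γ a b h.swap)) hab.swap d).le

end system

end ContLogic

/-! ### Group algebra representations along injective homomorphisms. -/

namespace GroupOp

/-- The coordinates of a vector in `ℓ²(G)` along an injective map `K → G`. -/
noncomputable def restrict {K : Type*} {G : Type u} {φ : K → G} (hφ : Function.Injective φ)
    (ξ : L2 G) : L2 K :=
  ⟨fun k => ξ (φ k), by
    have h := lp.memℓp ξ
    rw [memℓp_gen_iff (by norm_num)] at h
    exact memℓp_gen (h.comp_injective hφ)⟩

@[simp] theorem restrict_apply {K : Type*} {G : Type u} {φ : K → G} (hφ : Function.Injective φ)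
    (ξ : L2 G) (k : K) : restrict hφ ξ k = ξ (φ k) := rfl

theorem L2.summable_norm_sq {G : Type*} (ξ : L2 G) : Summable fun g => ‖ξ g‖ ^ 2 := by
  simpa using (lp.memℓp ξ).summable (by norm_num)

theorem L2.norm_sq_eq_tsum {G : Type*} (ξ : L2 G) : ‖ξ‖ ^ 2 = ∑' g, ‖ξ g‖ ^ 2 := by
  simpa using lp.norm_rpow_eq_tsum (p := 2) (by norm_num) ξ

theorem norm_restrict_le {K : Type*} {G : Type u} {φ : K → G} (hφ : Function.Injective φ) (ξ : L2 G) :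
    ‖restrict hφ ξ‖ ≤ ‖ξ‖ := by
  refine le_of_sq_le_sq ?_ (norm_nonneg _)
  rw [L2.norm_sq_eq_tsum, L2.norm_sq_eq_tsum]
  exact tsum_comp_le_tsum_of_inj (L2.summable_norm_sq ξ) (fun _ => by positivity) hφ

/-- The witness is the extension of `ξ` by zero off the range of `φ`. -/
theorem exists_restrict_eq {K : Type*} {G : Type u} {φ : K → G} (hφ : Function.Injective φ) (ξ : L2 K) :
    ∃ η : L2 G, restrict hφ η = ξ ∧ ‖η‖ = ‖ξ‖ := by
  have h : (fun g => ‖Function.extend φ ξ 0 g‖ ^ 2) = Function.extend φ (fun k => ‖ξ k‖ ^ 2) 0 := by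
    funext g
    by_cases hg : ∃ k, φ k = g
    · obtain ⟨k, rfl⟩ := hg
      simp [hφ.extend_apply]
    · simp [Function.extend_apply' _ _ _ hg]
  refine ⟨⟨Function.extend φ ξ 0, memℓp_gen ?_⟩, ?_, ?_⟩
  · have := (L2.summable_norm_sq ξ)
    rw [← summable_extend_zero hφ, ← h] at this
    simpa using this
  · ext k
    exact hφ.extend_apply _ _ _
  · rw [← sq_eq_sq₀ (norm_nonneg _) (norm_nonneg _), L2.norm_sq_eq_tsum, L2.norm_sq_eq_tsum,
      ← tsum_extend_zero hφ]
    exact tsum_congr fun g => congrFun h g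

section regMap

variable {K : Type w} {G : Type u} {H : Type v} [Group K] [Group G] [Group H] (f : K →* G) (g : K →* H)

/-- The representation of `ℂ[K]` on `ℓ²(G)` given by a homomorphism `K → G`. -/
noncomputable def regMap : MonoidAlgebra ℂ K →ₐ[ℂ] (L2 G →L[ℂ] L2 G) :=
  MonoidAlgebra.lift ℂ _ K ((leftReg G).comp f)

theorem regMap_single (k : K) (c : ℂ) : regMap f (MonoidAlgebra.single k c) = c • leftReg G (f k) := by
  simp [regMap]

theorem regMap_id : regMap (MonoidHom.id G) = leftRegAlg G := rfl

theorem regMap_mapDomain {K' : Type*} [Group K'] (e : K' →* K) (y : MonoidAlgebra ℂ K') :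
    regMap f (MonoidAlgebra.mapDomainAlgHom ℂ ℂ e y) = regMap (f.comp e) y := by
  induction y using MonoidAlgebra.induction_linear with
  | zero => simp
  | add y z hy hz => simp only [map_add, hy, hz]
  | single k c => simp [regMap_single]

theorem regMap_mem (y : MonoidAlgebra ℂ K) : regMap f y ∈ groupAlg G := by
  have := regMap_mapDomain (MonoidHom.id G) f y
  rw [MonoidHom.id_comp] at this
  exact ⟨_, this⟩

/-- The formal adjoint of `y` works. What matters is that one `z` serves both representations, so
that taking adjoints preserves having a common expression. -/
theorem exists_star_regMap (y : MonoidAlgebra ℂ K) :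
    ∃ z, star (regMap f y) = regMap f z ∧ star (regMap g y) = regMap g z := by
  induction y using MonoidAlgebra.induction_linear with
  | zero => exact ⟨0, by simp⟩
  | add y z hy hz =>
    obtain ⟨y', h₁, h₂⟩ := hy
    obtain ⟨z', h₃, h₄⟩ := hz
    exact ⟨y' + z', by simp only [map_add, star_add, *, and_self]⟩
  | single k c =>
    exact ⟨MonoidAlgebra.single k⁻¹ (star c), by simp [regMap_single, star_leftReg]⟩

open Classical in
theorem trace_regMap_single (hf : Function.Injective f) (k : K) (c : ℂ) :
    trace (regMap f (MonoidAlgebra.single k c)) = if k = 1 then c else 0 := by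
  rw [trace, regMap_single, inner_delta]
  change c * permOp (Equiv.mulLeft (f k)) (delta 1) 1 = _
  rw [permOp_delta]
  simp [delta, Pi.single_apply, ← map_eq_one_iff f hf, eq_comm]

/-- Both traces read off the coefficient of `y` at `1`, since an injective homomorphism sends no
other element to `1`. -/
theorem trace_regMap (hf : Function.Injective f) (hg : Function.Injective g) (y : MonoidAlgebra ℂ K) :
    trace (regMap f y) = trace (regMap g y) := by
  induction y using MonoidAlgebra.induction_linear with
  | zero => simp [trace]
  | add y z hy hz =>
    simp only [trace, map_add, add_apply, inner_add_right] at *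
    rw [hy, hz]
  | single k c => rw [trace_regMap_single f hf, trace_regMap_single g hg]

theorem twoNorm_regMap (hf : Function.Injective f) (hg : Function.Injective g)
    (y : MonoidAlgebra ℂ K) : twoNorm (regMap f y) = twoNorm (regMap g y) := by
  obtain ⟨z, h₁, h₂⟩ := exists_star_regMap f g y
  rw [twoNorm, twoNorm, h₁, h₂, ← map_mul, ← map_mul, trace_regMap f g hf hg]

/-- The coset `f(K) t` is stable under left multiplication by `f(K)`; in the coordinate `k ↦ f k *
t` this action is the left regular representation of `K`. -/
theorem restrict_regMap {t : G} (ht : Function.Injective fun k => f k * t) (y : MonoidAlgebra ℂ K)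
    (ξ : L2 G) : restrict ht (regMap f y ξ) = leftRegAlg K y (restrict ht ξ) := by
  induction y using MonoidAlgebra.induction_linear generalizing ξ with
  | zero => ext; simp
  | add y z hy hz =>
    simp only [map_add, add_apply, ← hy, ← hz]
    rfl
  | single k c =>
    rw [← regMap_id, regMap_single, regMap_single]
    ext l
    change c * ξ ((f k)⁻¹ * (f l * t)) = c * ξ (f (k⁻¹ * l) * t)
    rw [map_mul, map_inv, mul_assoc]

/-- The coset with `t = 1` already carries a copy of `ℓ²(K)`, into which vectors extend by zero
without change of norm. -/
theorem norm_leftRegAlg_le (hf : Function.Injective f) (y : MonoidAlgebra ℂ K) :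
    ‖leftRegAlg K y‖ ≤ ‖regMap f y‖ := by
  have h1 : Function.Injective fun k => f k * 1 := by simpa using hf
  refine ContinuousLinearMap.opNorm_le_bound _ (norm_nonneg _) fun ξ => ?_
  obtain ⟨η, rfl, h⟩ := exists_restrict_eq h1 ξ
  rw [← restrict_regMap, ← h]
  exact (norm_restrict_le h1 _).trans ((regMap f y).le_opNorm η)

/-- `ℓ²(G)` is the orthogonal sum of the spaces of the right cosets of `f(K)`, and on each of them
the operator acts as `leftRegAlg K y`. The bounds are squared and summed over the cosets. -/
theorem norm_regMap_le (hf : Function.Injective f) (y : MonoidAlgebra ℂ K) :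
    ‖regMap f y‖ ≤ ‖leftRegAlg K y‖ := by
  -- `T` is a set of coset representatives: each element of `G` is `f k * t` for exactly one pair.
  obtain ⟨T, hT, -⟩ := f.range.exists_isComplement_right 1
  have hi (t : T) : Function.Injective fun k => f k * t := (mul_left_injective _).comp hf
  have hb : Function.Bijective fun q : T × K => f q.2 * q.1 :=
    hT.comp ((MonoidHom.ofInjective hf).toEquiv.prodCongr (Equiv.refl T)).bijective |>.comp
      (Equiv.prodComm _ _).bijective
  let e : T × K ≃ G := Equiv.ofBijective _ hb
  have hs (ξ : L2 G) : Summable fun q : T × K => ‖ξ (e q)‖ ^ 2 :=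
    e.summable_iff.2 (L2.summable_norm_sq ξ)
  have hn (ξ : L2 G) : ‖ξ‖ ^ 2 = ∑' t : T, ‖restrict (hi t) ξ‖ ^ 2 := by
    simp only [L2.norm_sq_eq_tsum, ← e.tsum_eq fun g => ‖ξ g‖ ^ 2, (hs ξ).tsum_prod]
    rfl
  have hs' (ξ : L2 G) : Summable fun t : T => ‖restrict (hi t) ξ‖ ^ 2 := by
    simp only [L2.norm_sq_eq_tsum]
    exact (hs ξ).prod
  refine ContinuousLinearMap.opNorm_le_bound _ (norm_nonneg _) fun ξ => ?_
  refine le_of_sq_le_sq ?_ (by positivity)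
  rw [mul_pow, hn, hn ξ, ← tsum_mul_left]
  refine (hs' _).tsum_le_tsum (fun t => ?_) ((hs' ξ).mul_left _)
  rw [restrict_regMap, ← mul_pow]
  gcongr
  exact ContinuousLinearMap.le_opNorm _ _

/-- Injective homomorphisms into groups induce isometric embeddings of reduced C*-algebras. -/
theorem norm_regMap (hf : Function.Injective f) (hg : Function.Injective g) (y : MonoidAlgebra ℂ K) :
    ‖regMap f y‖ = ‖regMap g y‖ :=
  ((norm_regMap_le f hf y).antisymm (norm_leftRegAlg_le f hf y)).trans
    ((norm_leftRegAlg_le g hg y).antisymm (norm_regMap_le g hg y))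

end regMap

end GroupOp

/-! ### Density of the group algebra in the balls of both operator algebras. -/

namespace GroupOp

variable {G : Type u} [Group G]

theorem star_apply_delta_one {x : L2 G →L[ℂ] L2 G} (hx : x ∈ groupVN G) (g : G) :
    star x (delta 1) g = starRingEnd ℂ (x (delta 1) g⁻¹) := by
  rw [← inner_delta g, ContinuousLinearMap.star_eq_adjoint,
    ContinuousLinearMap.adjoint_inner_right, groupVN_delta hx, ← inner_conj_symm, inner_delta]
  change starRingEnd ℂ (x (delta 1) (1 * g⁻¹)) = _
  simp

theorem trace_mul (x y : L2 G →L[ℂ] L2 G) : trace (x * y) = inner ℂ (star x (delta 1)) (y (delta 1)) :=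
  (ContinuousLinearMap.adjoint_inner_left x (y (delta 1)) (delta 1)).symm

/-- In coefficients `tr(xy)` is the sum of `x(g⁻¹) y(g)` over `g`, and the substitution `g ↦ g⁻¹`
exchanges the factors. -/
theorem trace_mul_comm {x y : L2 G →L[ℂ] L2 G} (hx : x ∈ groupVN G) (hy : y ∈ groupVN G) :
    trace (x * y) = trace (y * x) := by
  rw [trace_mul, trace_mul, lp.inner_eq_tsum, lp.inner_eq_tsum, ← (Equiv.inv G).tsum_eq]
  refine tsum_congr fun g => ?_
  rw [star_apply_delta_one hx, star_apply_delta_one hy]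
  simp [mul_comm]

theorem redCStar_le_groupVN : redCStar G ≤ groupVN G := by
  intro x hx
  refine mem_sotClosure.2 fun F ε hε => ?_
  have hS : 0 < ∑ ξ ∈ F, ‖ξ‖ + 1 := by positivity
  obtain ⟨a, ha, h⟩ := Metric.mem_closure_iff.1 (show x ∈ closure (groupAlg G : Set _) from hx)
    (ε / (∑ ξ ∈ F, ‖ξ‖ + 1)) (by positivity)
  refine ⟨a, ha, fun ξ hξ => ?_⟩
  rw [dist_eq_norm, lt_div_iff₀ hS] at h
  have h1 : ‖ξ‖ ≤ ∑ ξ ∈ F, ‖ξ‖ := Finset.single_le_sum (f := fun ξ : L2 G => ‖ξ‖) (fun _ _ => norm_nonneg _) hξ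
  refine ((x - a).le_opNorm ξ).trans_lt (lt_of_le_of_lt ?_ h)
  gcongr
  linarith

/-- A regularized polar decomposition `b = (b a) k²` with `k² ≈ |b|`, inside a closed `*`-subalgebra. -/
theorem exists_regularized_polar {A : Type*} [CStarAlgebra A] (S : StarSubalgebra ℂ A)
    (hS : IsClosed (S : Set A)) {b : A} (hb : b ∈ S) {η : ℝ} (hη : 0 < η) :
    ∃ a ∈ S, ∃ k ∈ S, star a = a ∧ star k = k ∧ a * (k * k) = 1 ∧ ‖b * a‖ ≤ 1 ∧
      ‖k * k - star b * b * a‖ ≤ η := by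
  set h := star b * b with hh
  have hsa : IsSelfAdjoint h := IsSelfAdjoint.star_mul_self b
  have hpos : ∀ t ∈ spectrum ℝ h, 0 ≤ t := spectrum_star_mul_self_nonneg
  have hmem : h ∈ S := mul_mem (star_mem hb) hb
  have hs (t : ℝ) : 0 < √(|t| + η ^ 2) := Real.sqrt_pos.2 (by positivity)
  -- With `s = √(|t| + η²)`, the elements are `a = s⁻¹` and `k = √s` evaluated at `h = b* b`. The
  -- absolute value makes the functions continuous on all of `ℝ`, and `η²` keeps `s` away from zero.
  obtain ⟨m, hm, hmc⟩ : ∃ m : ℝ → ℝ, (∀ t, m t = (√(|t| + η ^ 2))⁻¹) ∧ Continuous m :=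
    ⟨_, fun _ => rfl, Continuous.inv₀ (by fun_prop) fun t => (hs t).ne'⟩
  obtain ⟨k, hkk, hkc⟩ : ∃ k : ℝ → ℝ, (∀ t, k t * k t = √(|t| + η ^ 2)) ∧ Continuous k :=
    ⟨fun t => √√(|t| + η ^ 2), fun t => Real.mul_self_sqrt (hs t).le, by fun_prop⟩
  have hm1 : ContinuousOn m (spectrum ℝ h) := hmc.continuousOn
  have hk1 : ContinuousOn k (spectrum ℝ h) := hkc.continuousOn
  have hid : ContinuousOn (fun t : ℝ => t) (spectrum ℝ h) := continuousOn_id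
  have hss (t : ℝ) : √(|t| + η ^ 2) * √(|t| + η ^ 2) = |t| + η ^ 2 :=
    Real.mul_self_sqrt (by positivity)
  have hAs : star (cfc m h) = cfc m h := cfc_predicate m h
  refine ⟨cfc m h, cfc_mem (hs := hS) (𝕜' := ℂ) m hmem, cfc k h, cfc_mem (hs := hS) (𝕜' := ℂ) k hmem,
    hAs, cfc_predicate k h, ?_, ?_, ?_⟩
  · rw [← cfc_mul k k h hk1 hk1, ← cfc_mul m (fun t => k t * k t) h hm1 (hk1.mul hk1),
      ← cfc_one ℝ h hsa]
    refine cfc_congr fun t _ => ?_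
    simp only [hkk, hm]
    exact inv_mul_cancel₀ (hs t).ne'
  · have hzz : star (b * cfc m h) * (b * cfc m h) = cfc (fun t => m t * (t * m t)) h := by
      rw [cfc_mul m (fun t => t * m t) h hm1 (hid.mul hm1), cfc_mul (fun t => t) m h hid hm1,
        cfc_id' ℝ h hsa, star_mul, hAs, hh]
      simp only [mul_assoc]
    have : ‖b * cfc m h‖ * ‖b * cfc m h‖ ≤ 1 := by
      rw [← CStarRing.norm_star_mul_self, hzz]
      refine norm_cfc_le zero_le_one fun t ht => ?_
      have h0 := hpos t ht
      have : m t * (t * m t) = t / (|t| + η ^ 2) := by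
        rw [← hss]; simp only [hm]; field_simp
      rw [this, Real.norm_eq_abs, abs_of_nonneg (by positivity), abs_of_nonneg h0]
      exact (div_le_one (by positivity)).2 (by nlinarith)
    nlinarith [norm_nonneg (b * cfc m h)]
  · have h4 : cfc k h * cfc k h - h * cfc m h = cfc (fun t => k t * k t - t * m t) h := by
      rw [cfc_sub (fun t => k t * k t) (fun t => t * m t) h (hk1.mul hk1) (hid.mul hm1),
        cfc_mul k k h hk1 hk1, cfc_mul (fun t => t) m h hid hm1, cfc_id' ℝ h hsa]
    rw [h4]
    refine norm_cfc_le hη.le fun t ht => ?_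
    have h0 := hpos t ht
    have h6 : η ≤ √(|t| + η ^ 2) := Real.le_sqrt_of_sq_le (by linarith [abs_nonneg t])
    -- For `t ≥ 0` this is `s - t/s = η²/s`, which is at most `η` because `s ≥ η`.
    have : k t * k t - t * m t = η ^ 2 / √(|t| + η ^ 2) := by
      rw [hkk]
      have := hss t
      rw [eq_div_iff (hs t).ne']
      simp only [hm]
      rw [sub_mul, mul_assoc, inv_mul_cancel₀ (hs t).ne', this, abs_of_nonneg h0]
      ring
    rw [this, Real.norm_eq_abs, abs_of_nonneg (by positivity), div_le_iff₀ (hs t)]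
    nlinarith

/-- The trace inequality behind the density of the unit ball of `C*_r(G)` in that of `L(G)`:
`z = b (b* b + η²)^{-1/2}` almost maximizes `Re tr(b* z)` over the unit ball of `L(G)`. -/
theorem exists_re_inner_le {b x : L2 G →L[ℂ] L2 G} (hb : b ∈ redCStar G) (hx : x ∈ groupVN G)
    (hx1 : ‖x‖ ≤ 1) {η : ℝ} (hη : 0 < η) : ∃ z ∈ redCStar G, ‖z‖ ≤ 1 ∧
      (inner ℂ (b (delta 1)) (x (delta 1))).re ≤ (inner ℂ (b (delta 1)) (z (delta 1))).re + η := by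
  obtain ⟨A, hAm, B, hBm, hAs, hBs, hABB, hz1, h5⟩ := exists_regularized_polar (redCStar G)
    (StarSubalgebra.isClosed_topologicalClosure _) hb hη
  have hBV := redCStar_le_groupVN hBm
  have hzV := redCStar_le_groupVN (mul_mem hb hAm)
  refine ⟨b * A, mul_mem hb hAm, hz1, ?_⟩
  -- Since `b* = B² (bA)*`, moving one factor `B` cyclically in `tr(b* x)` places the contraction
  -- `(bA)* x` between two copies of `B`. Cauchy–Schwarz then bounds the trace by `tr(B²)`.
  have h1 : inner ℂ (b (delta 1)) (x (delta 1)) = trace (B * (star (b * A) * x) * B) := by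
    rw [trace_mul_comm (mul_mem hBV (mul_mem (star_mem hzV) hx)) hBV]
    have : B * (B * (star (b * A) * x)) = star b * x := by
      have := congrArg star hABB
      rw [star_mul, star_mul, hBs, hAs, star_one] at this
      rw [star_mul, hAs, ← mul_assoc, ← mul_assoc, ← mul_assoc, this, one_mul]
    rw [this, trace_mul, star_star]
  have h2 : ‖trace (B * (star (b * A) * x) * B)‖ ≤ (trace (B * B)).re := by
    have e1 : trace (B * (star (b * A) * x) * B) =
        inner ℂ (B (delta 1)) ((star (b * A) * x) (B (delta 1))) := by
      rw [mul_assoc, trace_mul, hBs]; rfl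
    have e2 : (trace (B * B)).re = ‖B (delta 1)‖ * ‖B (delta 1)‖ := by
      rw [trace_mul, hBs]; exact inner_self_eq_norm_mul_norm (𝕜 := ℂ) _
    rw [e1, e2]
    refine (norm_inner_le_norm _ _).trans (mul_le_mul_of_nonneg_left ?_ (norm_nonneg _))
    refine (ContinuousLinearMap.le_opNorm _ _).trans (mul_le_of_le_one_left (norm_nonneg _) ?_)
    refine (norm_mul_le _ _).trans (mul_le_one₀ ?_ (norm_nonneg _) hx1)
    exact (norm_star (b * A)).trans_le hz1
  have h3 : inner ℂ (b (delta 1)) ((b * A) (delta 1)) = trace (star b * b * A) := by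
    rw [mul_assoc, trace_mul, star_star]
  -- The bound `tr(B²)` is nearly attained by `z = bA`, because `B²` is within `η` of `b* b A` in
  -- norm.
  have h6 : (trace (B * B)).re - (trace (star b * b * A)).re ≤ η := by
    rw [← Complex.sub_re, ← trace_sub]
    exact (Complex.re_le_norm _).trans ((norm_trace_le _).trans ((twoNorm_le _).trans h5))
  rw [h3, h1]
  linarith [Complex.re_le_norm (trace (B * (star (b * A) * x) * B))]

/-- Used to replace the vector of a separating functional by one of the form `b δ_e`, to which the
trace inequality applies. -/
theorem exists_groupAlg_near (ξ : L2 G) {ε : ℝ} (hε : 0 < ε) :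
    ∃ b ∈ groupAlg G, ‖ξ - b (delta 1)‖ < ε := by
  let T : (L2 G →L[ℂ] L2 G) →ₗ[ℂ] L2 G := (ContinuousLinearMap.apply ℂ (L2 G) (delta (1 : G))).toLinearMap
  let V : Submodule ℂ (L2 G) := (Subalgebra.toSubmodule (groupAlg G).toSubalgebra).map T
  have : ξ ∈ V.topologicalClosure :=
    delta_dense (P := fun ξ => ξ ∈ V.topologicalClosure) V.isClosed_topologicalClosure (zero_mem _)
      (fun _ _ => add_mem) (fun c g => V.le_topologicalClosure ⟨c • leftReg G g,
        ⟨MonoidAlgebra.single g c, by simp [leftRegAlg]⟩, by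
          change c • permOp (Equiv.mulLeft g) (delta 1) = _
          rw [permOp_delta]; simp⟩) ξ
  obtain ⟨_, ⟨b, hb, rfl⟩, h⟩ := Metric.mem_closure_iff.1 this ε hε
  exact ⟨b, hb, by rwa [dist_eq_norm] at h⟩

/-- The unit ball of `C*_r(G)` is `‖·‖₂`-dense in the unit ball of `L(G)`. -/
theorem exists_redCStar_near {x : L2 G →L[ℂ] L2 G} (hx : x ∈ groupVN G) (hx1 : ‖x‖ ≤ 1) {ε : ℝ}
    (hε : 0 < ε) : ∃ a ∈ redCStar G, ‖a‖ ≤ 1 ∧ twoNorm (x - a) < ε := by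
  -- Under `a ↦ a δ_e` the 2-norm becomes the Hilbert space norm, so the claim is that `x δ_e` lies
  -- in the closure of a convex subset of `ℓ²(G)`.
  let S : Set (L2 G) := (fun a : L2 G →L[ℂ] L2 G => a (delta 1)) '' {a | a ∈ redCStar G ∧ ‖a‖ ≤ 1}
  have hS : Convex ℝ S := by
    rintro _ ⟨a, ⟨ha, ha1⟩, rfl⟩ _ ⟨b, ⟨hb, hb1⟩, rfl⟩ s t hs ht hst
    refine ⟨(s : ℂ) • a + (t : ℂ) • b, ⟨add_mem ((redCStar G).smul_mem ha _)
      ((redCStar G).smul_mem hb _), ?_⟩, ?_⟩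
    · refine (norm_add_le _ _).trans ?_
      rw [norm_smul, norm_smul, Complex.norm_real, Complex.norm_real, Real.norm_of_nonneg hs,
        Real.norm_of_nonneg ht]
      nlinarith
    · simp only [add_apply, Complex.coe_smul]
      rfl
  have key : x (delta 1) ∈ closure S := by
    by_contra hn
    obtain ⟨f, u, hfu, hux⟩ :=
      RCLike.geometric_hahn_banach_closed_point (𝕜 := ℂ) hS.closure isClosed_closure hn
    let d : L2 G := (InnerProductSpace.toDual ℂ (L2 G)).symm f
    have hd (ξ : L2 G) : f ξ = inner ℂ d ξ := InnerProductSpace.toDual_symm_apply.symm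
    simp only [hd] at hfu hux
    -- Passing from `d` to `b δ_e`, from `x` to `z`, and back to `d` loses at most `γ / 4` each
    -- time, less than the gap `γ` in total.
    set γ := (inner ℂ d (x (delta 1))).re - u with hγ
    have hγ0 : 0 < γ := sub_pos.2 hux
    obtain ⟨b, hb, hbd⟩ := exists_groupAlg_near d (ε := γ / 4) (by positivity)
    have hbd' (y : L2 G →L[ℂ] L2 G) (hy : ‖y‖ ≤ 1) :
        |(inner ℂ d (y (delta 1))).re - (inner ℂ (b (delta 1)) (y (delta 1))).re| ≤ γ / 4 := by
      rw [← Complex.sub_re, ← inner_sub_left]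
      refine (Complex.abs_re_le_norm _).trans ((norm_inner_le_norm _ _).trans ?_)
      have h1 : ‖y (delta 1)‖ ≤ 1 := (y.le_of_opNorm_le hy _).trans (by rw [norm_delta, one_mul])
      nlinarith [norm_nonneg (d - b (delta 1))]
    obtain ⟨z, hz, hz1, h⟩ := exists_re_inner_le (StarSubalgebra.le_topologicalClosure _ hb) hx hx1
      (η := γ / 4) (by positivity)
    have h1 := abs_le.1 (hbd' x hx1)
    have h2 := abs_le.1 (hbd' z hz1)
    have h3 : (inner ℂ d (z (delta 1))).re < u := hfu _ (subset_closure ⟨z, ⟨hz, hz1⟩, rfl⟩)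
    linarith
  obtain ⟨_, ⟨a, ⟨ha, ha1⟩, rfl⟩, h⟩ := Metric.mem_closure_iff.1 key ε hε
  exact ⟨a, ha, ha1, by rwa [twoNorm_eq, sub_apply, ← dist_eq_norm]⟩

theorem redCStar_ball_dense {x : L2 G →L[ℂ] L2 G} (hx : x ∈ redCStar G) {r : ℝ} (hr : 0 < r)
    (hxr : ‖x‖ ≤ r) {ε : ℝ} (hε : 0 < ε) :
    ∃ y : MonoidAlgebra ℂ G, ‖leftRegAlg G y‖ ≤ r ∧ ‖x - leftRegAlg G y‖ < ε := by
  obtain ⟨_, ⟨y, rfl⟩, h⟩ := Metric.mem_closure_iff.1 (show x ∈ closure (groupAlg G : Set _) from hx)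
    (ε / 2) (by positivity)
  change dist x (leftRegAlg G y) < _ at h
  rw [dist_eq_norm] at h
  have hb : ‖leftRegAlg G y‖ ≤ r + ε / 2 := by
    have := norm_sub_norm_le (leftRegAlg G y) x
    rw [norm_sub_rev] at this
    linarith
  -- The approximant may leave the ball of radius `r` by `ε / 2`. Scaling by `t` brings it back and
  -- moves it by at most `ε / 2`.
  set t : ℝ := r / (r + ε / 2) with ht
  have ht0 : 0 ≤ t := by positivity
  have ht1 : 1 - t = ε / 2 / (r + ε / 2) := by rw [ht]; field_simp; ring
  have ht2 : 0 ≤ 1 - t := by rw [ht1]; positivity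
  refine ⟨(t : ℂ) • y, ?_, ?_⟩
  · rw [map_smul, norm_smul, Complex.norm_real, Real.norm_of_nonneg ht0]
    refine (mul_le_mul_of_nonneg_left hb ht0).trans_eq ?_
    rw [ht]; field_simp
  · have e : x - leftRegAlg G ((t : ℂ) • y) =
        (x - leftRegAlg G y) + ((1 - t : ℝ) : ℂ) • leftRegAlg G y := by
      rw [map_smul]; push_cast; module
    rw [e]
    refine (norm_add_le _ _).trans_lt ?_
    rw [norm_smul, Complex.norm_real, Real.norm_of_nonneg ht2]
    have : (1 - t) * ‖leftRegAlg G y‖ ≤ ε / 2 := by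
      refine (mul_le_mul_of_nonneg_left hb ht2).trans_eq ?_
      rw [ht1]; field_simp
    linarith

/-- After scaling to the unit ball, `x` is approximated in 2-norm from `C*_r(G)`, then in operator
norm from the group algebra; the operator norm dominates the 2-norm. -/
theorem groupVN_ball_dense {x : L2 G →L[ℂ] L2 G} (hx : x ∈ groupVN G) {r : ℝ} (hr : 0 < r)
    (hxr : ‖x‖ ≤ r) {ε : ℝ} (hε : 0 < ε) :
    ∃ y : MonoidAlgebra ℂ G, ‖leftRegAlg G y‖ ≤ r ∧ twoNorm (x - leftRegAlg G y) < ε := by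
  have hn (c : ℝ) (hc : 0 < c) : ‖(c : ℂ)‖ = c := by rw [Complex.norm_real, Real.norm_of_nonneg hc.le]
  obtain ⟨a, ha, ha1, hxa⟩ := exists_redCStar_near (x := ((r⁻¹ : ℝ) : ℂ) • x)
    ((groupVN G).smul_mem hx _) (by
      rw [norm_smul, hn _ (by positivity)]
      exact (inv_mul_le_one₀ hr).2 hxr) (ε := ε / 2 / r) (by positivity)
  obtain ⟨y, hy, hay⟩ := redCStar_ball_dense ((redCStar G).smul_mem ha (r : ℂ)) hr
    (by rw [norm_smul, hn r hr]; exact mul_le_of_le_one_right hr.le ha1) (half_pos hε)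
  refine ⟨y, hy, ?_⟩
  have hp := groupVN_isBallNorm G
  have e : x - leftRegAlg G y =
      (r : ℂ) • (((r⁻¹ : ℝ) : ℂ) • x - a) + ((r : ℂ) • a - leftRegAlg G y) := by
    rw [smul_sub, smul_smul, ← Complex.ofReal_mul, mul_inv_cancel₀ hr.ne', Complex.ofReal_one, one_smul]
    abel
  rw [e]
  refine (hp.add_le _ _).trans_lt ?_
  rw [hp.smul_eq, hn r hr]
  rw [lt_div_iff₀ hr] at hxa
  linarith [twoNorm_le ((r : ℂ) • a - leftRegAlg G y)]

end GroupOp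

/-! ### Preservation of atomic formulas by relations compatible with the operations. -/

namespace GroupOp

open ContLogic

section terms

variable {H : Type u} [NormedAddCommGroup H] [InnerProductSpace ℂ H] [CompleteSpace H]
  {H' : Type v} [NormedAddCommGroup H'] [InnerProductSpace ℂ H'] [CompleteSpace H']

/-- A relation between operators that is compatible with the `*`-algebra operations. -/
structure IsStarRel (R : (H →L[ℂ] H) → (H' →L[ℂ] H') → Prop) : Prop where
  zero : R 0 0
  one : R 1 1
  add : ∀ {x y x' y'}, R x x' → R y y' → R (x + y) (x' + y')
  mul : ∀ {x y x' y'}, R x x' → R y y' → R (x * y) (x' * y')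
  smul : ∀ (c : ℂ) {x x'}, R x x' → R (c • x) (c • x')
  star : ∀ {x x'}, R x x' → R (star x) (star x')

variable {A : StarSubalgebra ℂ (H →L[ℂ] H)} {B : StarSubalgebra ℂ (H' →L[ℂ] H')}
  {R : (H →L[ℂ] H) → (H' →L[ℂ] H') → Prop}

theorem IsStarRel.opFn (hR : IsStarRel R) (f : OpFn) (x : ∀ i, OpBall A (f.dom i))
    (y : ∀ i, OpBall B (f.dom i)) (h : ∀ i, R (x i).val (y i).val) :
    R (opFn A f x).val (opFn B f y).val := by
  cases f with
  | zero => exact hR.zero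
  | one => exact hR.one
  | add m n => exact hR.add (h (0 : Fin 2)) (h (1 : Fin 2))
  | mul m n => exact hR.mul (h (0 : Fin 2)) (h (1 : Fin 2))
  | smul c m n hc => exact hR.smul c (h (0 : Fin 1))
  | star n => exact hR.star (h (0 : Fin 1))
  | incl m n hmn => exact h (0 : Fin 1)

variable {p : (H →L[ℂ] H) → ℝ} {q : (H' →L[ℂ] H') → ℝ} (hp : IsBallNorm A p) (hq : IsBallNorm B q)
  {Rel : Type} {srt : Rel → ℕ+} {rel : Rel → (H →L[ℂ] H) → ℝ} {rel' : Rel → (H' →L[ℂ] H') → ℝ}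
  (hrel : ∀ R, ∀ x ∈ A, ∀ y ∈ A, |rel R x - rel R y| ≤ p (x - y)) (hrel0 : ∀ R x, |rel R x| ≤ ‖x‖)
  (hrel' : ∀ R, ∀ x ∈ B, ∀ y ∈ B, |rel' R x - rel' R y| ≤ q (x - y))
  (hrel0' : ∀ R x, |rel' R x| ≤ ‖x‖)

/-- The relation between elements of balls given by a relation between operators. -/
def ballRel (R : (H →L[ℂ] H) → (H' →L[ℂ] H') → Prop) (n : ℕ+) (x : OpBall A n) (y : OpBall B n) : Prop :=
  R x.val y.val

theorem IsStarRel.term_eval (hR : IsStarRel R) {Γ : List (opLang Rel srt).Srt}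
    {a : Tuple (opStructure hp Rel srt rel hrel hrel0).carrier Γ}
    {b : Tuple (opStructure hq Rel srt rel' hrel' hrel0').carrier Γ}
    (hab : Tuple.Rel (ballRel R) a b) {s : (opLang Rel srt).Srt} (t : Term (opLang Rel srt) Γ s) :
    ballRel R (A := A) (B := B) s (t.eval _ a) (t.eval _ b) := by
  induction t with
  | var i => exact hab.get i
  | app f t ih => exact hR.opFn f _ _ ih

theorem IsStarRel.atomic_eval (hR : IsStarRel R) (hpq : ∀ x y, R x y → p x = q y)
    (hrr : ∀ S x y, R x y → rel S x = rel' S y) {Γ : List (opLang Rel srt).Srt}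
    {a : Tuple (opStructure hp Rel srt rel hrel hrel0).carrier Γ}
    {b : Tuple (opStructure hq Rel srt rel' hrel' hrel0').carrier Γ}
    (hab : Tuple.Rel (ballRel R) a b) (φ : Atomic (opLang Rel srt) Γ) :
    φ.eval _ a = φ.eval _ b := by
  cases φ with
  | dist s t₁ t₂ =>
    refine hpq _ _ ?_
    -- The metric is the norm of a difference, obtained here from addition and multiplication by
    -- `-1`.
    have := hR.add (hR.term_eval hp hq hrel hrel0 hrel' hrel0' hab t₁)
      (hR.smul (-1) (hR.term_eval hp hq hrel hrel0 hrel' hrel0' hab t₂))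
    simpa only [neg_smul, one_smul, ← sub_eq_add_neg] using this
  | rel S t => exact hrr S _ _ (hR.term_eval hp hq hrel hrel0 hrel' hrel0' hab (t (0 : Fin 1)))

end terms

/-! ### Finite matchings of generators and the back-and-forth argument. -/

/-- A finite partial matching between two sets. -/
structure FinMatch (I : Type u) (J : Type v) where
  X : Type
  [finite : Finite X]
  left : X ↪ I
  right : X ↪ J

namespace FinMatch

variable {I : Type u} {J : Type v}

def swap (m : FinMatch I J) : FinMatch J I :=
  have := m.finite
  ⟨m.X, m.right, m.left⟩

/-- The finitely many unmatched points of `E` are sent to unused points of `J`. This is the only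
place where the rank being infinite matters. -/
theorem exists_extension [Infinite J] (m : FinMatch I J) {E : Set I} (hE : E.Finite) :
    ∃ m' : FinMatch I J, E ⊆ Set.range m'.left ∧
      ∃ e : m.X → m'.X, m'.left ∘ e = m.left ∧ m'.right ∘ e = m.right := by
  have := m.finite
  have h1 : Finite ↥(E \ Set.range m.left) := hE.subset Set.sdiff_subset
  obtain ⟨k, ⟨e⟩⟩ := Finite.exists_equiv_fin ↥(E \ Set.range m.left)
  have : Infinite ↥(Set.range m.right)ᶜ := (Set.finite_range m.right).infinite_compl.to_subtype
  let j := Infinite.natEmbedding ↥(Set.range m.right)ᶜ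
  refine ⟨⟨m.X ⊕ Fin k, ⟨Sum.elim m.left fun i => (e.symm i : I), ?_⟩,
    ⟨Sum.elim m.right fun i => (j i : J), ?_⟩⟩, ?_, Sum.inl, rfl, rfl⟩
  · exact m.left.injective.sumElim (Subtype.val_injective.comp e.symm.injective)
      fun x i h => (e.symm i).2.2 ⟨x, h⟩
  · exact m.right.injective.sumElim
      (Subtype.val_injective.comp (j.injective.comp Fin.val_injective)) fun x i h => (j i).2 ⟨x, h⟩
  · intro i hi
    by_cases h : i ∈ Set.range m.left
    · obtain ⟨x, rfl⟩ := h
      exact ⟨Sum.inl x, rfl⟩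
    · exact ⟨Sum.inr (e ⟨i, hi, h⟩), by simp⟩

/-- Operators over the two free groups that have the same expression in the matched generators. -/
def opRel (m : FinMatch I J) (x : L2 (FreeGroup I) →L[ℂ] L2 (FreeGroup I))
    (x' : L2 (FreeGroup J) →L[ℂ] L2 (FreeGroup J)) : Prop :=
  ∃ y, x = regMap (FreeGroup.map m.left) y ∧ x' = regMap (FreeGroup.map m.right) y

theorem opRel_isStarRel (m : FinMatch I J) : IsStarRel m.opRel where
  zero := ⟨0, by simp⟩
  one := ⟨1, by simp⟩
  add := by rintro _ _ _ _ ⟨y, rfl, rfl⟩ ⟨z, rfl, rfl⟩; exact ⟨y + z, by simp⟩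
  mul := by rintro _ _ _ _ ⟨y, rfl, rfl⟩ ⟨z, rfl, rfl⟩; exact ⟨y * z, by simp⟩
  smul := by rintro c _ _ ⟨y, rfl, rfl⟩; exact ⟨c • y, by simp⟩
  star := by rintro _ _ ⟨y, rfl, rfl⟩; exact exists_star_regMap _ _ y

end FinMatch

/-- A word has finitely many letters. Allowing every `f` whose range contains `E` makes the property
stable under enlarging `E`, as needed for products and sums. -/
theorem exists_finite_mem_range_map {I : Type u} (g : FreeGroup I) :
    ∃ E : Set I, E.Finite ∧ ∀ (X : Type) (f : X → I), E ⊆ Set.range f →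
      g ∈ (FreeGroup.map f).range := by
  induction g using FreeGroup.induction_on with
  | C1 => exact ⟨∅, Set.finite_empty, fun _ _ _ => one_mem _⟩
  | of i =>
    refine ⟨{i}, Set.finite_singleton i, fun X f h => ?_⟩
    obtain ⟨x, rfl⟩ := h rfl
    exact ⟨FreeGroup.of x, by simp⟩
  | inv_of i ih =>
    obtain ⟨E, hE, h⟩ := ih
    exact ⟨E, hE, fun X f hf => inv_mem (h X f hf)⟩
  | mul g h hg hh =>
    obtain ⟨E, hE, h₁⟩ := hg
    obtain ⟨F, hF, h₂⟩ := hh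
    exact ⟨E ∪ F, hE.union hF, fun X f hf =>
      mul_mem (h₁ X f (Set.subset_union_left.trans hf)) (h₂ X f (Set.subset_union_right.trans hf))⟩

theorem exists_finite_regMap_eq {I : Type u} (y : MonoidAlgebra ℂ (FreeGroup I)) :
    ∃ E : Set I, E.Finite ∧ ∀ (X : Type) (f : X → I), E ⊆ Set.range f →
      ∃ z, regMap (FreeGroup.map f) z = leftRegAlg (FreeGroup I) y := by
  induction y using MonoidAlgebra.induction_linear with
  | zero => exact ⟨∅, Set.finite_empty, fun _ _ _ => ⟨0, by simp⟩⟩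
  | add y z hy hz =>
    obtain ⟨E, hE, h₁⟩ := hy
    obtain ⟨F, hF, h₂⟩ := hz
    refine ⟨E ∪ F, hE.union hF, fun X f hf => ?_⟩
    obtain ⟨y', hy'⟩ := h₁ X f (Set.subset_union_left.trans hf)
    obtain ⟨z', hz'⟩ := h₂ X f (Set.subset_union_right.trans hf)
    exact ⟨y' + z', by simp [hy', hz']⟩
  | single g c =>
    obtain ⟨E, hE, h⟩ := exists_finite_mem_range_map g
    refine ⟨E, hE, fun X f hf => ?_⟩
    obtain ⟨k, rfl⟩ := h X f hf
    exact ⟨MonoidAlgebra.single k c, by rw [← regMap_id, regMap_single, regMap_single]; rfl⟩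

section freeGroup

variable {I : Type u} {J : Type v}
  {A : StarSubalgebra ℂ (L2 (FreeGroup I) →L[ℂ] L2 (FreeGroup I))}
  {B : StarSubalgebra ℂ (L2 (FreeGroup J) →L[ℂ] L2 (FreeGroup J))}
  {p : (L2 (FreeGroup I) →L[ℂ] L2 (FreeGroup I)) → ℝ}
  {q : (L2 (FreeGroup J) →L[ℂ] L2 (FreeGroup J)) → ℝ}

/-- A nearby group algebra element of the same ball uses finitely many generators; once these are
matched, the same expression in their partners is the answer. -/
theorem FinMatch.forth [Infinite J] (hA : groupAlg (FreeGroup I) ≤ A)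
    (hB : groupAlg (FreeGroup J) ≤ B)
    (hd : ∀ x ∈ A, ∀ r : ℝ, 0 < r → ‖x‖ ≤ r → ∀ ε : ℝ, 0 < ε →
      ∃ y, ‖leftRegAlg (FreeGroup I) y‖ ≤ r ∧ p (x - leftRegAlg (FreeGroup I) y) < ε)
    (m : FinMatch I J) (n : ℕ+) (c : OpBall A n) (ε : ℝ≥0) (hε : 0 < ε) :
    ∃ m' : FinMatch I J, (∀ x y, m.opRel x y → m'.opRel x y) ∧
      ∃ (c' : OpBall A n) (d : OpBall B n), m'.opRel c'.val d.val ∧ p (c.val - c'.val) ≤ ε := by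
  obtain ⟨y, hy, hcy⟩ := hd c.val c.mem n (by exact_mod_cast n.pos) c.norm_le ε hε
  obtain ⟨E, hE, h⟩ := exists_finite_regMap_eq y
  obtain ⟨m', hm', e, he₁, he₂⟩ := m.exists_extension hE
  obtain ⟨z, hz⟩ := h _ _ hm'
  refine ⟨m', ?_, ⟨leftRegAlg _ y, hA ⟨y, rfl⟩, hy⟩,
    ⟨regMap (FreeGroup.map m'.right) z, hB (regMap_mem _ z), ?_⟩, ⟨z, hz.symm, rfl⟩, hcy.le⟩
  · rintro _ _ ⟨w, rfl, rfl⟩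
    -- Pairs matched earlier stay matched: their expression is rewritten in the larger set of
    -- generators along `e`.
    refine ⟨MonoidAlgebra.mapDomainAlgHom ℂ ℂ (FreeGroup.map e) w, ?_, ?_⟩
    · rw [regMap_mapDomain, ← he₁]
      exact congrArg (regMap · w) (FreeGroup.ext_hom _ _ fun x => by simp)
    · rw [regMap_mapDomain, ← he₂]
      exact congrArg (regMap · w) (FreeGroup.ext_hom _ _ fun x => by simp)
  -- The answer lies in the ball of the same radius because both embeddings are isometric.
  · rw [norm_regMap _ (FreeGroup.map m'.left) (FreeGroup.map_injective m'.right.injective)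
      (FreeGroup.map_injective m'.left.injective), hz]
    exact hy

variable (hp : IsBallNorm A p) (hq : IsBallNorm B q)
  {Rel : Type} {srt : Rel → ℕ+} {rel : Rel → (L2 (FreeGroup I) →L[ℂ] L2 (FreeGroup I)) → ℝ}
  {rel' : Rel → (L2 (FreeGroup J) →L[ℂ] L2 (FreeGroup J)) → ℝ}
  (hrel : ∀ R, ∀ x ∈ A, ∀ y ∈ A, |rel R x - rel R y| ≤ p (x - y)) (hrel0 : ∀ R x, |rel R x| ≤ ‖x‖)
  (hrel' : ∀ R, ∀ x ∈ B, ∀ y ∈ B, |rel' R x - rel' R y| ≤ q (x - y))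
  (hrel0' : ∀ R x, |rel' R x| ≤ ‖x‖)

/-- Operator algebras of two free groups of infinite rank, with metric and predicates that only depend
on the group algebra element, are back-and-forth equivalent. -/
theorem inftyEquiv_opStructure [Infinite I] [Infinite J] (Ω : WeakModulus)
    (hA : groupAlg (FreeGroup I) ≤ A) (hB : groupAlg (FreeGroup J) ≤ B)
    (hdA : ∀ x ∈ A, ∀ r : ℝ, 0 < r → ‖x‖ ≤ r → ∀ ε : ℝ, 0 < ε →
      ∃ y, ‖leftRegAlg (FreeGroup I) y‖ ≤ r ∧ p (x - leftRegAlg (FreeGroup I) y) < ε)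
    (hdB : ∀ x ∈ B, ∀ r : ℝ, 0 < r → ‖x‖ ≤ r → ∀ ε : ℝ, 0 < ε →
      ∃ y, ‖leftRegAlg (FreeGroup J) y‖ ≤ r ∧ q (x - leftRegAlg (FreeGroup J) y) < ε)
    (hpq : ∀ {K : Type} [Group K] (f : K →* FreeGroup I) (g : K →* FreeGroup J),
      Function.Injective f → Function.Injective g → ∀ y, p (regMap f y) = q (regMap g y))
    (hrr : ∀ {K : Type} [Group K] (f : K →* FreeGroup I) (g : K →* FreeGroup J),
      Function.Injective f → Function.Injective g → ∀ S y, rel S (regMap f y) = rel' S (regMap g y)) :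
    InftyEquiv.{u, v, w} Ω (opStructure hp Rel srt rel hrel hrel0)
      (opStructure hq Rel srt rel' hrel' hrel0') := by
  intro α
  -- The game starts from the empty matching and empty tuples.
  refine bfDist_eq_zero (P := FinMatch I J) (r := fun m => ballRel m.opRel) ?_ ?_ ?_ α
    ⟨Empty, Function.Embedding.ofIsEmpty, Function.Embedding.ofIsEmpty⟩ [] _ _ trivial
  · intro m Γ a b hab φ
    refine m.opRel_isStarRel.atomic_eval hp hq hrel hrel0 hrel' hrel0' ?_ ?_ hab φ
    · rintro _ _ ⟨y, rfl, rfl⟩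
      exact hpq _ _ (FreeGroup.map_injective m.left.injective)
        (FreeGroup.map_injective m.right.injective) y
    · rintro S _ _ ⟨y, rfl, rfl⟩
      exact hrr _ _ (FreeGroup.map_injective m.left.injective)
        (FreeGroup.map_injective m.right.injective) S y
  · intro m n c ε hε
    obtain ⟨m', h, c', d, hcd, hc⟩ := m.forth hA hB hdA n c ε hε
    exact ⟨m', fun _ x y hxy => h _ _ hxy, c', d, hcd, hc⟩
  · intro m n d ε hε
    obtain ⟨m', h, d', c, ⟨y, h₁, h₂⟩, hd⟩ := m.swap.forth hB hA hdB n d ε hε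
    refine ⟨m'.swap, ?_, d', c, ⟨y, h₂, h₁⟩, hd⟩
    rintro _ x y ⟨z, h₁, h₂⟩
    obtain ⟨z', h₃, h₄⟩ := h _ _ ⟨z, h₂, h₁⟩
    exact ⟨z', h₄, h₃⟩

end freeGroup

end GroupOp

theorem mainTheorem9 (κ : Cardinal.{u}) (μ : Cardinal.{v}) (hκ : Cardinal.aleph0 ≤ κ)
    (hμ : Cardinal.aleph0 ≤ μ) :
    (∀ Ω : ContLogic.WeakModulus,
      ContLogic.InftyEquiv.{u, v, w} Ω (GroupOp.vnStructure (FreeGroupOfRank κ))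
        (GroupOp.vnStructure (FreeGroupOfRank μ))) ∧
    (∀ Ω : ContLogic.WeakModulus,
      ContLogic.InftyEquiv.{u, v, w} Ω (GroupOp.cstarStructure (FreeGroupOfRank κ))
        (GroupOp.cstarStructure (FreeGroupOfRank μ))) := by
  have : Infinite κ.out := Cardinal.infinite_iff.2 (by rwa [Cardinal.mk_out])
  have : Infinite μ.out := Cardinal.infinite_iff.2 (by rwa [Cardinal.mk_out])
  constructor
  · intro Ω
    refine GroupOp.inftyEquiv_opStructure _ _ _ _ _ _ Ω (GroupOp.subset_sotClosure _)
      (GroupOp.subset_sotClosure _) (fun x hx r hr hxr ε hε => GroupOp.groupVN_ball_dense hx hr hxr hε)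
      (fun x hx r hr hxr ε hε => GroupOp.groupVN_ball_dense hx hr hxr hε) GroupOp.twoNorm_regMap ?_
    intro K _ f g hf hg S y
    cases S with
    | re n => exact congrArg Complex.re (GroupOp.trace_regMap f g hf hg y)
    | im n => exact congrArg Complex.im (GroupOp.trace_regMap f g hf hg y)
  · intro Ω
    exact GroupOp.inftyEquiv_opStructure _ _ _ _ _ _ Ω (StarSubalgebra.le_topologicalClosure _)
      (StarSubalgebra.le_topologicalClosure _)
      (fun x hx r hr hxr ε hε => GroupOp.redCStar_ball_dense hx hr hxr hε)
      (fun x hx r hr hxr ε hε => GroupOp.redCStar_ball_dense hx hr hxr hε) GroupOp.norm_regMap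
      fun _ _ _ _ S => S.elim
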